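/- Let $\mathbb K$ be a non-archimedean local field with ring of integers $\mathcal O$ and uniformizer $\varpi$. Let $\mathfrak g=\bigoplus_{k\ge 1}V_k$, $[V_i,V_j]\subseteq V_{i+j}$, be a finite-dimensional graded nilpotent Lie algebra over $\mathbb K$, and assume that every integer $1\le n\le c$ is invertible in $\mathbb K$, where $c$ is the nilpotency class of $\mathfrak g$ (no condition if $\operatorname{char}\mathbb K=0$). Let $G$ be its Lie group (a graded $\mathbb K$-Lie group): a topological group with a homeomorphism $\exp:\mathfrak g\to G$ such that $\exp(x)\exp(y)=\exp(x\diamond y)$, where $\diamond$ is the Baker–Campbell–Hausdorff product. Let $Q=\sum_k k\dim V_k$ be the homogeneous dimension, and let $D_\gamma$, $\gamma\in\mathbb K^*$, be the dilation of $\mathfrak g$ acting as $\gamma^k$ on $V_k$. Fix a basis $X_1,\dots,X_d$ of $\mathfrak g$ with each $X_i$ in some $V_k$, put $\mathfrak g_0=\mathcal O X_1+\dots+\mathcal O X_d$ and $G_n=\exp(D_{\varpi^n}\mathfrak g_0)$ for $n\in\mathbb Z$, and let $dx$ be the Haar measure $|\cdot|$ on $G$ with $|G_0|=1$. The homogeneous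 quasi-norm on $G$ is $|e|_G=0$ and $|x|_G=|G_n|^{1/Q}$ for $x\in G_n\setminus G_{n+1}$. **Theorem.** Let $1<r\le s<\infty$, let $a\in\mathbb C$ with $0<\operatorname{Re}(a)<Q/r$, and let $0\le b<Q$ with $$\frac{\operatorname{Re}(a)}{Q}=\frac1r-\frac1s+\frac{b}{sQ}.$$ Then there is a constant $C_1>0$, depending only on $G$ (with the above data), $r,s,a,b$, such that the following holds. Let $C_0>0$ and let $K_a:G\to\mathbb C$ be a measurable function with $|K_a(x)|\le C_0|x|_G^{\operatorname{Re}(a)-Q}$ for all $x\ne e$. Then for every $f\in L^r(G)$ the convolution $(f*K_a)(x)=\int_G f(y)K_a(y^{-1}x)\,dy$ converges absolutely for almost every $x\in G$, and $$\Big\|\frac{f*K_a}{|x|_G^{b/s}}\Big\|_{L^s(G)}\le C_0\,C_1\,\|f\|_{L^r(G)} .$$ -/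

import Mathlib

open MeasureTheory
open scoped ValuativeRel

noncomputable section

namespace GradedKLie

section BakerCampbellHausdorff

/-- The right-nested bracket `⁅x₁, ⁅x₂, … ⁅xₙ₋₁, xₙ⁆⁆⁆` of a word `x₁ x₂ … xₙ`. -/
def nestedBracket {L : Type*} [LieRing L] : List L → L
  | [] => 0
  | [x] => x
  | x :: y :: l => ⁅x, nestedBracket (y :: l)⁆

/-- The word `x^{r₁} y^{s₁} ⋯ x^{rₖ} y^{sₖ}`, where `p i = (rᵢ, sᵢ)`. -/
def dynkinWord {L : Type*} (x y : L) {k : ℕ} (p : Fin k → ℕ × ℕ) : List L :=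
  (List.ofFn fun i => List.replicate (p i).1 x ++ List.replicate (p i).2 y).flatten

/-- The coefficient `(-1)^{k-1} / (k · ∑ᵢ (rᵢ + sᵢ) · ∏ᵢ rᵢ! sᵢ!)` in Dynkin's formula. -/
def dynkinCoeff (K : Type*) [Field K] {k : ℕ} (p : Fin k → ℕ × ℕ) : K :=
  (-1) ^ (k + 1) /
    ((k : K) * ((∑ i, ((p i).1 + (p i).2) : ℕ) : K) *
      ((∏ i, ((p i).1.factorial * (p i).2.factorial) : ℕ) : K))

/-- Dynkin's formula for `log (exp x * exp y)`, with at most `c` blocks `x^{rᵢ} y^{sᵢ} ≠ 1` and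
with `rᵢ, sᵢ ≤ c`. All terms of total degree at most `c` occur in it. -/
def dynkinSum (K : Type*) [Field K] {L : Type*} [LieRing L] [LieAlgebra K L]
    (c : ℕ) (x y : L) : L :=
  ∑ k ∈ Finset.Icc 1 c,
    ∑ p ∈ Fintype.piFinset fun _ : Fin k =>
        (Finset.range (c + 1) ×ˢ Finset.range (c + 1)).filter fun t => t ≠ (0, 0),
      dynkinCoeff K p • nestedBracket (dynkinWord x y p)

/-- The Baker-Campbell-Hausdorff product `x ⋄ y` on a nilpotent Lie algebra: brackets of more than
`c` letters vanish when `c` is the nilpotency class, so this is the full Dynkin series. -/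
def bch (K : Type*) [Field K] {L : Type*} [LieRing L] [LieAlgebra K L] (x y : L) : L :=
  dynkinSum K (LieModule.nilpotencyLength L L) x y

end BakerCampbellHausdorff

/-- `G` is the nilpotent Lie group of the nilpotent Lie algebra `𝔤` over `K`: there is an
exponential map `exp : 𝔤 → G`, a homeomorphism that carries the Baker-Campbell-Hausdorff product
of `𝔤` to the multiplication of `G`. -/
structure LieExp (K 𝔤 G : Type*) [Field K] [LieRing 𝔤] [LieAlgebra K 𝔤] [TopologicalSpace 𝔤]
    [Group G] [TopologicalSpace G] extends 𝔤 ≃ₜ G where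
  /-- The group law in exponential coordinates. -/
  exp_mul_exp : ∀ x y : 𝔤, toFun x * toFun y = toFun (bch K x y)

section Graded

variable {K 𝔤 : Type*} [Field K] [LieRing 𝔤] [LieAlgebra K 𝔤]

/-- The homogeneous dimension `Q = ∑ₖ k · dim Vₖ` of `𝔤 = ⨁ₖ Vₖ`. -/
def homDim (V : ℕ → Submodule K 𝔤) : ℕ :=
  ∑ᶠ k : ℕ, k * Module.finrank K (V k)

/-- The dilation `D_γ` of `𝔤 = ⨁ₖ Vₖ`, the linear map that is `γ ^ k` on `Vₖ`. -/
def dilation (V : ℕ → Submodule K 𝔤) [GradedLieAlgebra V] (γ : K) : 𝔤 →ₗ[K] 𝔤 :=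
  DirectSum.toModule K ℕ 𝔤 (fun k => γ ^ k • (V k).subtype) ∘ₗ
    (DirectSum.decomposeLinearEquiv V).toLinearMap

/-- The lattice `𝔤₀ = 𝒪 X₁ + ⋯ + 𝒪 X_d` of a basis `X₁, …, X_d` of `𝔤`. -/
def lattice [ValuativeRel K] {ι : Type*} (X : Module.Basis ι K 𝔤) : Set 𝔤 :=
  {v | ∀ i, X.repr v i ∈ 𝒪[K]}

variable [ValuativeRel K] [TopologicalSpace 𝔤] {G : Type*} [Group G] [TopologicalSpace G]

/-- The sets `Gₙ = exp (D_γ 𝔤₀)`, `n ∈ ℤ`, where `γ = ϖ ^ n`, for a uniformizer `ϖ`. -/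
def filtration (e : LieExp K 𝔤 G) (V : ℕ → Submodule K 𝔤) [GradedLieAlgebra V]
    {ι : Type*} (X : Module.Basis ι K 𝔤) (ϖ : 𝒪[K]) (n : ℤ) : Set G :=
  (fun v => e.toHomeomorph (dilation V ((ϖ : K) ^ n) v)) '' lattice X

open Classical in
/-- The homogeneous quasi-norm `|x|_G`: it is `|Gₙ| ^ (1 / Q)` for `x ∈ Gₙ \ Gₙ₊₁`, and `0` at the
identity (which lies in every `Gₙ`). Here `|Gₙ|` is the `μ`-measure of `Gₙ`. -/
def quasiNorm [MeasurableSpace G] (μ : Measure G) (e : LieExp K 𝔤 G)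
    (V : ℕ → Submodule K 𝔤) [GradedLieAlgebra V]
    {ι : Type*} (X : Module.Basis ι K 𝔤) (ϖ : 𝒪[K]) (x : G) : ℝ :=
  if h : ∃ n : ℤ, x ∈ filtration e V X ϖ n ∧ x ∉ filtration e V X ϖ (n + 1) then
    (μ.real (filtration e V X ϖ h.choose)) ^ (1 / (homDim V : ℝ))
  else 0

end Graded

/-- The convolution `(f * k)(x) = ∫ f(y) k(y⁻¹ x) dy` on a group. -/
def groupConv {G : Type*} [Group G] [MeasurableSpace G] (μ : Measure G) (f k : G → ℂ) (x : G) : ℂ :=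
  ∫ y, f y * k (y⁻¹ * x) ∂μ

end GradedKLie

end

/-! Put `φ x = |x|_G ^ Q`, `A = Re a / Q` and `B = b / (s Q)`. The claim becomes an `L^r → L^s`
bound for `g ↦ φ(x)^{-B} ∫ g(y) φ(y⁻¹x)^{A-1} dy` with `A = 1/r - 1/s + B`. Its proof uses only that
the measure is left invariant and that the sets `{φ x < t}` and `{φ x⁻¹ < t}` have measure `O(t)`;
no triangle inequality for the quasi-norm enters.

Analysis. Split the kernel at `φ = t`. The near part has `L^1` norm of order `t^A`, so Young and
Chebyshev make its contribution at most of order `t^(A-1/r) ‖g‖_r` off a set of measure `t`. The far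
part is in `L^{r'}` because `A < 1/r`, and Hölder bounds its contribution everywhere by the same
quantity. Discarding also `{φ < t}`, where the weight is large, leaves `φ^{-B} ≤ t^{-B}`. Optimising
in `t` gives weak type `(q, p)` with `1/p = 1/q - A + B` for every `1 < q < 1/A`
(`exists_weakType_fracInt`). For fixed `A, B` these exponents lie on a line of slope one in the
`(1/q, 1/p)` plane, with `q ≤ p`, so Marcinkiewicz interpolation between one `q` below `r` and one
above gives the strong bound (`exists_lintegral_fracInt_rpow_le`).

Geometry. A dilation preserves brackets, hence the Baker-Campbell-Hausdorff product, hence induces a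
topological automorphism of `G`. It multiplies Haar measure by a constant `ρ` and carries `Gₙ` to
`Gₙ₊₁`, so `|Gₙ| = ρ ^ n`. As it commutes with inversion, `|Gₙ⁻¹| = κ ρ ^ n`
(`exists_measure_filtration_eq`). Each sublevel set of `φ` at a positive level is some `Gₙ`, which
supplies the growth bounds. -/

namespace GradedKLie

open scoped ENNReal

/-! ### Layer cake formulas and integrals of powers over geometric shells -/

section Integrals

/-- The layer cake formula for a power of an extended nonnegative number. -/
theorem lintegral_Ioi_rpow_ite_lt {e : ℝ} (he : 0 < e) (F : ℝ≥0∞) :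
    ∫⁻ h in Set.Ioi (0 : ℝ), (if ENNReal.ofReal h < F then ENNReal.ofReal (h ^ (e - 1)) else 0) =
      ENNReal.ofReal (1 / e) * F ^ e := by
  have key : ∀ T : ℝ, 0 < T → ∫⁻ h in Set.Ioo (0 : ℝ) T, ENNReal.ofReal (h ^ (e - 1)) =
      ENNReal.ofReal (T ^ e / e) := by
    intro T hT
    have hi : IntervalIntegrable (fun h : ℝ => h ^ (e - 1)) volume 0 T :=
      intervalIntegral.intervalIntegrable_rpow' (by linarith)
    rw [Measure.restrict_congr_set Ioo_ae_eq_Ioc,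
      ← ofReal_integral_eq_lintegral_ofReal]
    · rw [← intervalIntegral.integral_of_le hT.le, integral_rpow (Or.inl (by linarith))]
      simp [Real.zero_rpow he.ne']
    · exact (intervalIntegrable_iff_integrableOn_Ioc_of_le hT.le).1 hi
    · filter_upwards [ae_restrict_mem measurableSet_Ioc] with h hh
      exact Real.rpow_nonneg hh.1.le _
  have hind : ∀ s : Set ℝ, MeasurableSet s → s ⊆ Set.Ioi 0 →
      (∀ h : ℝ, 0 < h → (ENNReal.ofReal h < F ↔ h ∈ s)) →
      ∫⁻ h in Set.Ioi (0 : ℝ), (if ENNReal.ofReal h < F then ENNReal.ofReal (h ^ (e - 1)) else 0) =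
      ∫⁻ h in s, ENNReal.ofReal (h ^ (e - 1)) := by
    intro s hs hs0 h
    rw [← Set.inter_eq_self_of_subset_left hs0, ← Measure.restrict_restrict hs,
      ← lintegral_indicator hs]
    refine setLIntegral_congr_fun measurableSet_Ioi fun x hx => ?_
    have hx' := h x hx
    by_cases hxs : x ∈ s <;> simp_all
  induction F with
  | top =>
    rw [hind (Set.Ioi 0) measurableSet_Ioi subset_rfl (by simp), ENNReal.top_rpow_of_pos he,
      ENNReal.mul_top (by simp [he])]
    refine ENNReal.eq_top_of_forall_nnreal_le fun r => ?_
    -- For this `T` the integral over `(0, T)` equals `r + 1`; the `+ 1` keeps `T` positive when `r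
    -- = 0`.
    have hT : 0 < (e * (r + 1)) ^ (1 / e) := by positivity
    calc (r : ℝ≥0∞) ≤ ENNReal.ofReal (((e * (r + 1)) ^ (1 / e)) ^ e / e) := by
          rw [← Real.rpow_mul (by positivity), one_div_mul_cancel he.ne', Real.rpow_one,
            mul_div_cancel_left₀ _ he.ne']
          rw [← ENNReal.ofReal_coe_nnreal]
          exact ENNReal.ofReal_le_ofReal (by linarith)
      _ = _ := (key _ hT).symm
      _ ≤ _ := lintegral_mono_set fun x hx => hx.1
  | coe F =>
    rcases eq_or_ne F 0 with rfl | hF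
    · simp [he]
    have hF' : (0 : ℝ) < F := by positivity
    rw [hind (Set.Ioo 0 F) measurableSet_Ioo (fun x hx => hx.1), key F hF', div_eq_mul_one_div,
      mul_comm, ENNReal.ofReal_mul (by positivity), ← ENNReal.ofReal_rpow_of_pos hF',
      ENNReal.ofReal_coe_nnreal]
    intro h h0
    rw [← ENNReal.ofReal_coe_nnreal, ENNReal.ofReal_lt_ofReal_iff hF']
    simp [h0]

/-- The tail counterpart of the layer cake formula, for the part of a function below height `h`.
Since an upper bound suffices, `F = 0` is free: the right side is then `⊤`. -/
theorem lintegral_Ioi_rpow_ite_le {e : ℝ} (he : 0 < e) (F : ℝ≥0∞) :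
    ∫⁻ h in Set.Ioi (0 : ℝ), (if F ≤ ENNReal.ofReal h then ENNReal.ofReal (h ^ (-e - 1)) else 0) ≤
      ENNReal.ofReal (1 / e) * F ^ (-e) := by
  induction F with
  | top => simp
  | coe F =>
    rcases eq_or_ne F 0 with rfl | hF
    · simp [he]
    have hF' : (0 : ℝ) < F := by positivity
    have hpt : ∀ h : ℝ, 0 < h → ((F : ℝ≥0∞) ≤ ENNReal.ofReal h ↔ h ∈ Set.Ici (F : ℝ)) := by
      intro h h0
      rw [← ENNReal.ofReal_coe_nnreal, ENNReal.ofReal_le_ofReal_iff h0.le]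
      simp
    refine le_of_eq ?_
    have hs0 : Set.Ici (F : ℝ) ⊆ Set.Ioi 0 := fun x hx => hF'.trans_le hx
    calc _ = ∫⁻ h in Set.Ici (F : ℝ), ENNReal.ofReal (h ^ (-e - 1)) := by
          conv_rhs => rw [← Set.inter_eq_self_of_subset_left hs0,
            ← Measure.restrict_restrict measurableSet_Ici, ← lintegral_indicator measurableSet_Ici]
          refine setLIntegral_congr_fun measurableSet_Ioi fun x hx => ?_
          simp only [Set.indicator, hpt x hx]
      _ = ∫⁻ h in Set.Ioi (F : ℝ), ENNReal.ofReal (h ^ (-e - 1)) := by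
          rw [Measure.restrict_congr_set Ioi_ae_eq_Ici]
      _ = ENNReal.ofReal ((F : ℝ) ^ (-e) / e) := by
          rw [← ofReal_integral_eq_lintegral_ofReal]
          · rw [integral_Ioi_rpow_of_lt (by linarith) hF']
            congr 1
            simp
          · exact integrableOn_Ioi_rpow_of_lt (by linarith) hF'
          · filter_upwards [ae_restrict_mem measurableSet_Ioi] with h hh
            exact Real.rpow_nonneg (hF'.trans hh).le _
      _ = _ := by
          rw [div_eq_mul_one_div, mul_comm, ENNReal.ofReal_mul (by positivity),
            ← ENNReal.ofReal_rpow_of_pos hF', ENNReal.ofReal_coe_nnreal]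

variable {α : Type*} [MeasurableSpace α] {μ : Measure α}

/-- Let `t → 0` in the growth bound. This makes harmless the real powers at `φ = 0`, where a
negative power is `0` and not infinite. -/
theorem measure_nonpos_eq_zero {φ : α → ℝ} {c : ℝ}
    (hc : ∀ t : ℝ, 0 < t → μ {x | φ x < t} ≤ ENNReal.ofReal (c * t)) : μ {x | φ x ≤ 0} = 0 := by
  refine le_antisymm (ge_of_tendsto' (x := Filter.atTop)
    (f := fun n : ℕ => ENNReal.ofReal (c * (1 / ((n : ℝ) + 1)))) ?_ fun n => ?_) bot_le
  · have := (tendsto_one_div_add_atTop_nhds_zero_nat (𝕜 := ℝ)).const_mul c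
    rw [mul_zero] at this
    simpa using ENNReal.tendsto_ofReal this
  · have hn : (0 : ℝ) < 1 / ((n : ℝ) + 1) := by positivity
    exact (measure_mono fun x hx => lt_of_le_of_lt hx hn).trans (hc _ hn)

/-- A sum over geometric shells bounds the integral of a negative power of a function whose
sublevel sets grow at most linearly. -/
theorem setLIntegral_rpow_le_of_geometric {φ : α → ℝ} (hφ : Measurable φ) {c : ℝ}
    (hc : ∀ t : ℝ, 0 < t → μ {x | φ x < t} ≤ ENNReal.ofReal (c * t)) (hc0 : 0 ≤ c)
    {p θ u : ℝ} (hp : 0 ≤ p) (hθ : 0 < θ) (hθp : θ ^ (1 - p) < 1) (hu : 0 < u) {S : Set α}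
    (hS : S ⊆ {x | φ x ≤ 0} ∪ ⋃ n : ℕ, {x | u * θ ^ n ≤ φ x ∧ φ x ≤ 2 * (u * θ ^ n)}) :
    ∫⁻ x in S, ENNReal.ofReal (φ x ^ (-p)) ∂μ ≤
      ENNReal.ofReal (3 * c / (1 - θ ^ (1 - p)) * u ^ (1 - p)) := by
  have hnull := measure_nonpos_eq_zero hc
  have hq : 0 ≤ θ ^ (1 - p) := by positivity
  calc _ ≤ ∫⁻ x in {x | φ x ≤ 0} ∪ ⋃ n : ℕ, {x | u * θ ^ n ≤ φ x ∧ φ x ≤ 2 * (u * θ ^ n)},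
          ENNReal.ofReal (φ x ^ (-p)) ∂μ := lintegral_mono_set hS
    _ ≤ ∫⁻ x in {x | φ x ≤ 0}, ENNReal.ofReal (φ x ^ (-p)) ∂μ +
        ∫⁻ x in ⋃ n : ℕ, {x | u * θ ^ n ≤ φ x ∧ φ x ≤ 2 * (u * θ ^ n)},
          ENNReal.ofReal (φ x ^ (-p)) ∂μ := lintegral_union_le _ _ _
    _ = ∫⁻ x in ⋃ n : ℕ, {x | u * θ ^ n ≤ φ x ∧ φ x ≤ 2 * (u * θ ^ n)},
          ENNReal.ofReal (φ x ^ (-p)) ∂μ := by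
        rw [Measure.restrict_zero_set hnull]; simp
    _ ≤ ∑' n : ℕ, ∫⁻ x in {x | u * θ ^ n ≤ φ x ∧ φ x ≤ 2 * (u * θ ^ n)},
          ENNReal.ofReal (φ x ^ (-p)) ∂μ := lintegral_iUnion_le _ _
    _ ≤ ∑' n : ℕ, ENNReal.ofReal (3 * c * u ^ (1 - p) * (θ ^ (1 - p)) ^ n) := by
        refine ENNReal.tsum_le_tsum fun n => ?_
        have hv : 0 < u * θ ^ n := by positivity
        calc _ ≤ ∫⁻ x in {x | u * θ ^ n ≤ φ x ∧ φ x ≤ 2 * (u * θ ^ n)},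
              ENNReal.ofReal ((u * θ ^ n) ^ (-p)) ∂μ := by
              refine setLIntegral_mono' ((measurableSet_le measurable_const hφ).inter
                (measurableSet_le hφ measurable_const)) fun x hx => ?_
              exact ENNReal.ofReal_le_ofReal
                (Real.rpow_le_rpow_of_nonpos hv hx.1 (neg_nonpos.2 hp))
          _ ≤ ENNReal.ofReal ((u * θ ^ n) ^ (-p)) * ENNReal.ofReal (c * (3 * (u * θ ^ n))) := by
              -- The growth bound concerns strict sublevel sets, so `φ ≤ 2v` is enclosed in `φ <
              -- 3v`; hence the factor 3.
              rw [setLIntegral_const]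
              gcongr
              exact (measure_mono fun x hx => lt_of_le_of_lt hx.2 (by linarith)).trans (hc _ (by positivity))
          _ = _ := by
              rw [← ENNReal.ofReal_mul (by positivity)]
              congr 1
              have : (θ ^ (1 - p)) ^ n = (θ ^ n) ^ (1 - p) := by
                rw [← Real.rpow_natCast, ← Real.rpow_natCast, ← Real.rpow_mul hθ.le,
                  ← Real.rpow_mul hθ.le, mul_comm]
              rw [this, mul_assoc (3 * c), ← Real.mul_rpow hu.le (by positivity), sub_eq_add_neg,
                Real.rpow_add hv, Real.rpow_one]
              ring
    _ = _ := by
        rw [← ENNReal.ofReal_tsum_of_nonneg (fun n => by positivity)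
          ((summable_geometric_of_lt_one hq hθp).mul_left _), tsum_mul_left,
          tsum_geometric_of_lt_one hq hθp]
        congr 1
        ring

/-- Shells shrink by halves from `t / 2`, and `p < 1` makes their contributions summable. The `+ 1`
in the constant only secures positivity when `c = 0`. -/
theorem setLIntegral_rpow_lt_le {φ : α → ℝ} (hφ : Measurable φ) {c : ℝ}
    (hc : ∀ t : ℝ, 0 < t → μ {x | φ x < t} ≤ ENNReal.ofReal (c * t)) (hc0 : 0 ≤ c)
    {p : ℝ} (hp : 0 ≤ p) (hp1 : p < 1) :
    ∃ C : ℝ, 0 < C ∧ ∀ t : ℝ, 0 < t →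
      ∫⁻ x in {x | φ x < t}, ENNReal.ofReal (φ x ^ (-p)) ∂μ ≤ ENNReal.ofReal (C * t ^ (1 - p)) := by
  have hθ : (1 / 2 : ℝ) ^ (1 - p) < 1 :=
    Real.rpow_lt_one (by norm_num) (by norm_num) (by linarith)
  have hd : 0 < 1 - (1 / 2 : ℝ) ^ (1 - p) := by linarith
  refine ⟨3 * c / (1 - (1 / 2 : ℝ) ^ (1 - p)) * (1 / 2 : ℝ) ^ (1 - p) + 1, by positivity,
    fun t ht => ?_⟩
  refine (setLIntegral_rpow_le_of_geometric hφ hc hc0 hp (u := t * (1 / 2)) (θ := 1 / 2)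
    (by norm_num) hθ (by positivity) ?_).trans ?_
  · intro x hx
    rcases le_or_gt (φ x) 0 with h0 | h0
    · exact Or.inl h0
    right
    obtain ⟨n, hn1, hn2⟩ := exists_nat_pow_near_of_lt_one (y := (1 / 2 : ℝ)) (x := φ x / t)
      (by positivity) ((div_le_one ht).2 (le_of_lt hx)) (by norm_num) (by norm_num)
    refine Set.mem_iUnion.2 ⟨n, ?_, ?_⟩
    · rw [lt_div_iff₀ ht, pow_succ] at hn1
      linarith
    · rw [div_le_iff₀ ht] at hn2
      linarith
  · refine ENNReal.ofReal_le_ofReal ?_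
    rw [Real.mul_rpow ht.le (by norm_num)]
    have : 0 ≤ t ^ (1 - p) := by positivity
    nlinarith

/-- Shells double from `t` outwards, and now `p > 1` gives convergence. -/
theorem setLIntegral_rpow_ge_le {φ : α → ℝ} (hφ : Measurable φ) {c : ℝ}
    (hc : ∀ t : ℝ, 0 < t → μ {x | φ x < t} ≤ ENNReal.ofReal (c * t)) (hc0 : 0 ≤ c)
    {p : ℝ} (hp1 : 1 < p) :
    ∃ C : ℝ, 0 < C ∧ ∀ t : ℝ, 0 < t →
      ∫⁻ x in {x | t ≤ φ x}, ENNReal.ofReal (φ x ^ (-p)) ∂μ ≤ ENNReal.ofReal (C * t ^ (1 - p)) := by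
  have hθ : (2 : ℝ) ^ (1 - p) < 1 :=
    Real.rpow_lt_one_of_one_lt_of_neg (by norm_num) (by linarith)
  have hd : 0 < 1 - (2 : ℝ) ^ (1 - p) := by linarith
  refine ⟨3 * c / (1 - (2 : ℝ) ^ (1 - p)) + 1, by positivity, fun t ht => ?_⟩
  refine (setLIntegral_rpow_le_of_geometric hφ hc hc0 (by linarith) (u := t) (θ := 2)
    (by norm_num) hθ ht ?_).trans ?_
  · intro x hx
    right
    obtain ⟨n, hn1, hn2⟩ := exists_nat_pow_near (y := (2 : ℝ)) (x := φ x / t)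
      ((one_le_div ht).2 hx) (by norm_num)
    rw [le_div_iff₀ ht] at hn1
    rw [div_lt_iff₀ ht, pow_succ] at hn2
    exact Set.mem_iUnion.2 ⟨n, by linarith, by linarith⟩
  · refine ENNReal.ofReal_le_ofReal ?_
    have : 0 ≤ t ^ (1 - p) := by positivity
    nlinarith

end Integrals

/-! ### Marcinkiewicz interpolation -/

section Interpolation

variable {α : Type*} [MeasurableSpace α] {μ : Measure α}

/-- An a priori bound on `J` absorbs the excess power. Off the diagonal the weak type bound contains
`J ^ (s₀ / r₀)`; it has to be linear in `J` before Tonelli can be used in `h`. -/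
theorem rpow_le_mul_of_le {J : ℝ≥0∞} {h e θ : ℝ} (hh : 0 < h) (hθ : 1 ≤ θ)
    (hJ : J ≤ ENNReal.ofReal (h ^ e)) : J ^ θ ≤ J * ENNReal.ofReal (h ^ (e * (θ - 1))) := by
  calc J ^ θ = J ^ (1 + (θ - 1)) := by ring_nf
    _ = J * J ^ (θ - 1) := by
      rw [ENNReal.rpow_add_of_nonneg _ _ zero_le_one (by linarith), ENNReal.rpow_one]
    _ ≤ J * ENNReal.ofReal (h ^ e) ^ (θ - 1) := by
      gcongr
    _ = _ := by
      rw [ENNReal.ofReal_rpow_of_pos (by positivity), ← Real.rpow_mul hh.le]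

/-- Where `f > h`, the negative power `f ^ (r₀ - r)` is at most `h ^ (r₀ - r)`. This is the a priori
bound for the high part of `f`. -/
theorem lintegral_high_le {f : α → ℝ≥0∞} {r r₀ : ℝ} (hr₀ : r₀ < r)
    (hf1 : ∫⁻ x, f x ^ r ∂μ ≤ 1) {h : ℝ} (hh : 0 < h) :
    ∫⁻ x, (if ENNReal.ofReal h < f x then f x ^ r₀ else 0) ∂μ ≤ ENNReal.ofReal (h ^ (r₀ - r)) := by
  calc _ ≤ ∫⁻ x, ENNReal.ofReal (h ^ (r₀ - r)) * f x ^ r ∂μ := by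
        refine lintegral_mono fun x => ?_
        dsimp only
        split_ifs with hx
        · rcases eq_or_ne (f x) ⊤ with hT | hT
          · rw [hT]
            rcases le_or_gt r 0 with h0 | h0
            · simp [ENNReal.top_rpow_of_neg (hr₀.trans_le h0)]
            · rw [ENNReal.top_rpow_of_pos h0, ENNReal.mul_top (by simpa using by positivity)]
              exact le_top
          · have hx0 : f x ≠ 0 := (bot_le.trans_lt hx).ne'
            calc f x ^ r₀ = f x ^ (r₀ - r) * f x ^ r := by
                  rw [← ENNReal.rpow_add _ _ hx0 hT]; ring_nf
              _ ≤ ENNReal.ofReal h ^ (r₀ - r) * f x ^ r := by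
                  gcongr ?_ * _
                  rw [← neg_sub, ENNReal.rpow_neg, ENNReal.rpow_neg]
                  exact ENNReal.inv_le_inv.2 (ENNReal.rpow_le_rpow hx.le (by linarith))
              _ = _ := by rw [ENNReal.ofReal_rpow_of_pos hh]
        · exact bot_le
    _ ≤ ENNReal.ofReal (h ^ (r₀ - r)) * ∫⁻ x, f x ^ r ∂μ := by
        rw [lintegral_const_mul' _ _ ENNReal.ofReal_ne_top]
    _ ≤ _ := mul_le_of_le_one_right' hf1

theorem lintegral_low_le {f : α → ℝ≥0∞} {r r₁ : ℝ} (hr : 0 < r) (hr₁ : r < r₁)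
    (hf1 : ∫⁻ x, f x ^ r ∂μ ≤ 1) {h : ℝ} (hh : 0 < h) :
    ∫⁻ x, (if f x ≤ ENNReal.ofReal h then f x ^ r₁ else 0) ∂μ ≤ ENNReal.ofReal (h ^ (r₁ - r)) := by
  calc _ ≤ ∫⁻ x, ENNReal.ofReal (h ^ (r₁ - r)) * f x ^ r ∂μ := by
        refine lintegral_mono fun x => ?_
        dsimp only
        split_ifs with hx
        · calc f x ^ r₁ = f x ^ (r₁ - r) * f x ^ r := by
                  rw [← ENNReal.rpow_add_of_nonneg _ _ (by linarith) hr.le]; ring_nf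
              _ ≤ ENNReal.ofReal h ^ (r₁ - r) * f x ^ r := by
                  gcongr ?_ * _
                  exact ENNReal.rpow_le_rpow hx (by linarith)
              _ = _ := by rw [ENNReal.ofReal_rpow_of_pos hh]
        · exact bot_le
    _ ≤ ENNReal.ofReal (h ^ (r₁ - r)) * ∫⁻ x, f x ^ r ∂μ := by
        rw [lintegral_const_mul' _ _ ENNReal.ofReal_ne_top]
    _ ≤ _ := mul_le_of_le_one_right' hf1

/-- By Tonelli, for fixed `x` the height `h` runs over `(0, f x)` and the power of `h` integrates to
a multiple of `f x ^ (r - r₀)`, restoring the exponent `r`. -/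
theorem lintegral_Ioi_mul_high_le [SFinite μ] {f : α → ℝ≥0∞} (hf : Measurable f) {r r₀ : ℝ}
    (h0 : 0 < r₀) (hr₀ : r₀ < r) (hf1 : ∫⁻ x, f x ^ r ∂μ ≤ 1) :
    ∫⁻ h in Set.Ioi (0 : ℝ), ENNReal.ofReal (h ^ (r - r₀ - 1)) *
      ∫⁻ x, (if ENNReal.ofReal h < f x then f x ^ r₀ else 0) ∂μ ≤
      ENNReal.ofReal (1 / (r - r₀)) := by
  calc _ = ∫⁻ h in Set.Ioi (0 : ℝ), ∫⁻ x, f x ^ r₀ *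
        (if ENNReal.ofReal h < f x then ENNReal.ofReal (h ^ (r - r₀ - 1)) else 0) ∂μ := by
        congr with h
        rw [← lintegral_const_mul' _ _ ENNReal.ofReal_ne_top]
        congr with x
        split_ifs <;> simp [mul_comm]
    _ = ∫⁻ x, (∫⁻ h in Set.Ioi (0 : ℝ), f x ^ r₀ *
        (if ENNReal.ofReal h < f x then ENNReal.ofReal (h ^ (r - r₀ - 1)) else 0)) ∂μ := by
        refine lintegral_lintegral_swap (Measurable.aemeasurable ?_)
        refine ((hf.comp measurable_snd).pow_const _).mul (Measurable.ite ?_ (by fun_prop) (by fun_prop))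
        exact measurableSet_lt (by fun_prop) (by fun_prop)
    _ = ∫⁻ x, ENNReal.ofReal (1 / (r - r₀)) * f x ^ r ∂μ := by
        congr with x
        have hm : Measurable fun h : ℝ =>
            (if ENNReal.ofReal h < f x then ENNReal.ofReal (h ^ (r - r₀ - 1)) else 0) :=
          Measurable.ite (measurableSet_lt (by fun_prop) (by fun_prop)) (by fun_prop) (by fun_prop)
        rw [lintegral_const_mul _ hm, lintegral_Ioi_rpow_ite_lt (by linarith), mul_left_comm,
          ← ENNReal.rpow_add_of_nonneg _ _ h0.le (by linarith)]
        ring_nf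
    _ ≤ _ := by
        rw [lintegral_const_mul' _ _ ENNReal.ofReal_ne_top]
        exact mul_le_of_le_one_right' hf1

theorem lintegral_Ioi_mul_low_le [SFinite μ] {f : α → ℝ≥0∞} (hf : Measurable f) {r r₁ : ℝ}
    (h0 : 0 < r) (hr₁ : r < r₁) (hf1 : ∫⁻ x, f x ^ r ∂μ ≤ 1) :
    ∫⁻ h in Set.Ioi (0 : ℝ), ENNReal.ofReal (h ^ (r - r₁ - 1)) *
      ∫⁻ x, (if f x ≤ ENNReal.ofReal h then f x ^ r₁ else 0) ∂μ ≤
      ENNReal.ofReal (1 / (r₁ - r)) := by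
  calc _ = ∫⁻ h in Set.Ioi (0 : ℝ), ∫⁻ x, f x ^ r₁ *
        (if f x ≤ ENNReal.ofReal h then ENNReal.ofReal (h ^ (r - r₁ - 1)) else 0) ∂μ := by
        congr with h
        rw [← lintegral_const_mul' _ _ ENNReal.ofReal_ne_top]
        congr with x
        split_ifs <;> simp [mul_comm]
    _ = ∫⁻ x, (∫⁻ h in Set.Ioi (0 : ℝ), f x ^ r₁ *
        (if f x ≤ ENNReal.ofReal h then ENNReal.ofReal (h ^ (r - r₁ - 1)) else 0)) ∂μ := by
        refine lintegral_lintegral_swap (Measurable.aemeasurable ?_)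
        refine ((hf.comp measurable_snd).pow_const _).mul (Measurable.ite ?_ (by fun_prop) (by fun_prop))
        exact measurableSet_le (by fun_prop) (by fun_prop)
    _ ≤ ∫⁻ x, ENNReal.ofReal (1 / (r₁ - r)) * f x ^ r ∂μ := by
        refine lintegral_mono fun x => ?_
        have hm : Measurable fun h : ℝ =>
            (if f x ≤ ENNReal.ofReal h then ENNReal.ofReal (h ^ (r - r₁ - 1)) else 0) :=
          Measurable.ite (measurableSet_le (by fun_prop) (by fun_prop)) (by fun_prop) (by fun_prop)
        have hk := lintegral_Ioi_rpow_ite_le (e := r₁ - r) (by linarith) (f x)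
        rw [neg_sub] at hk
        rw [lintegral_const_mul _ hm]
        refine (mul_le_mul_right hk _).trans ?_
        rw [mul_left_comm]
        gcongr
        rcases eq_or_ne (f x) 0 with h | h
        · simp [h, h0.trans hr₁]
        rcases eq_or_ne (f x) ⊤ with h' | h'
        · simp [h', h0]
        rw [← ENNReal.rpow_add _ _ h h']
        ring_nf
        rfl
    _ ≤ _ := by
        rw [lintegral_const_mul' _ _ ENNReal.ofReal_ne_top]
        exact mul_le_of_le_one_right' hf1

/-- `T` is of weak type `(r, s)`, with constant `D`. -/
def WeakType (μ : Measure α) (T : (α → ℝ≥0∞) → α → ℝ≥0∞) (r s D : ℝ) : Prop :=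
  ∀ g : α → ℝ≥0∞, Measurable g → ∀ l : ℝ, 0 < l →
    μ {x | ENNReal.ofReal l < T g x} ≤ ENNReal.ofReal (D * l ^ (-s)) * (∫⁻ x, g x ^ r ∂μ) ^ (s / r)

/-- The weak type bound at level `h ^ (r / s)`, linearised by the a priori bound. No order between
`r₀` and `r` is assumed, so it serves both endpoints. -/
theorem WeakType.mul_measure_le {T : (α → ℝ≥0∞) → α → ℝ≥0∞} {r s r₀ s₀ D : ℝ}
    (hT : WeakType μ T r₀ s₀ D) (hD : 0 ≤ D) (hr : 0 < r) (hs : 0 < s) (hr₀ : 0 < r₀)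
    (hrs₀ : r₀ ≤ s₀) (hrel : 1 / r - 1 / s = 1 / r₀ - 1 / s₀) {g : α → ℝ≥0∞} (hg : Measurable g)
    {h : ℝ} (hh : 0 < h) (hJ : ∫⁻ x, g x ^ r₀ ∂μ ≤ ENNReal.ofReal (h ^ (r₀ - r))) :
    ENNReal.ofReal (h ^ (r - 1)) * μ {x | ENNReal.ofReal (h ^ (r / s)) < T g x} ≤
      ENNReal.ofReal D * (ENNReal.ofReal (h ^ (r - r₀ - 1)) * ∫⁻ x, g x ^ r₀ ∂μ) := by
  have hs₀ : 0 < s₀ := hr₀.trans_le hrs₀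
  have hθ : 1 ≤ s₀ / r₀ := (one_le_div hr₀).2 hrs₀
  calc _ ≤ ENNReal.ofReal (h ^ (r - 1)) * (ENNReal.ofReal (D * (h ^ (r / s)) ^ (-s₀)) *
        ((∫⁻ x, g x ^ r₀ ∂μ) * ENNReal.ofReal (h ^ ((r₀ - r) * (s₀ / r₀ - 1))))) := by
        gcongr
        exact (hT g hg _ (by positivity)).trans
          (mul_le_mul_right (rpow_le_mul_of_le hh hθ hJ) _)
    _ = ENNReal.ofReal (h ^ (r - 1) * (D * (h ^ (r / s)) ^ (-s₀)) *
        h ^ ((r₀ - r) * (s₀ / r₀ - 1))) * ∫⁻ x, g x ^ r₀ ∂μ := by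
        rw [ENNReal.ofReal_mul (by positivity), ENNReal.ofReal_mul (by positivity),
          ENNReal.ofReal_mul (by positivity), ENNReal.ofReal_mul hD, mul_comm (∫⁻ x, g x ^ r₀ ∂μ)]
        simp only [mul_assoc]
    _ = _ := by
        rw [← mul_assoc (ENNReal.ofReal D), ← ENNReal.ofReal_mul hD]
        congr 2
        rw [← Real.rpow_mul hh.le, mul_left_comm, mul_assoc, ← Real.rpow_add hh,
          ← Real.rpow_add hh]
        congr 2
        -- The powers of `h` match because both exponent pairs lie on the same line of slope one.
        have hk : r - 1 + (r / s * -s₀ + (r₀ - r) * (s₀ / r₀ - 1)) - (r - r₀ - 1) =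
            r * s₀ * (1 / r - 1 / s - (1 / r₀ - 1 / s₀)) := by
          field_simp
          ring
        rw [hrel, sub_self, mul_zero] at hk
        linarith

/-- Marcinkiewicz interpolation, off the diagonal, along a line of slope one. -/
theorem exists_lintegral_rpow_le_of_weakType [SFinite μ] {T : (α → ℝ≥0∞) → α → ℝ≥0∞}
    (hTm : ∀ g, Measurable g → Measurable (T g))
    (hTadd : ∀ f g, Measurable f → Measurable g → ∀ x, T (f + g) x ≤ T f x + T g x)
    {r s r₀ s₀ r₁ s₁ D : ℝ} (hD : 0 ≤ D) (hs : 0 < s) (hr₀ : 0 < r₀) (h0r : r₀ < r) (hr1 : r < r₁)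
    (hrs₀ : r₀ ≤ s₀) (hrs₁ : r₁ ≤ s₁) (hrel₀ : 1 / r - 1 / s = 1 / r₀ - 1 / s₀)
    (hrel₁ : 1 / r - 1 / s = 1 / r₁ - 1 / s₁)
    (h₀ : WeakType μ T r₀ s₀ D) (h₁ : WeakType μ T r₁ s₁ D) :
    ∃ C : ℝ, 0 < C ∧ ∀ f : α → ℝ≥0∞, Measurable f → ∫⁻ x, f x ^ r ∂μ ≤ 1 →
      ∫⁻ x, T f x ^ s ∂μ ≤ ENNReal.ofReal C := by
  have hr : 0 < r := hr₀.trans h0r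
  have e₀ : 0 < r - r₀ := by linarith
  have e₁ : 0 < r₁ - r := by linarith
  refine ⟨2 ^ s * (r * (D * (1 / (r - r₀)) + D * (1 / (r₁ - r)))) + 1, by positivity,
    fun f hf hf1 => ?_⟩
  -- The cut height `h` varies with the level: it is paired with the level `h ^ (r / s)` of each
  -- part of `T f`.
  let hi (h : ℝ) (x : α) : ℝ≥0∞ := if ENNReal.ofReal h < f x then f x else 0
  let lo (h : ℝ) (x : α) : ℝ≥0∞ := if f x ≤ ENNReal.ofReal h then f x else 0
  have hhi : ∀ h, Measurable (hi h) := fun h =>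
    Measurable.ite (measurableSet_lt measurable_const hf) hf measurable_const
  have hlo : ∀ h, Measurable (lo h) := fun h =>
    Measurable.ite (measurableSet_le hf measurable_const) hf measurable_const
  have hsum : ∀ h, hi h + lo h = f := by
    intro h
    ext1 x
    by_cases hx : ENNReal.ofReal h < f x
    · simp [hi, lo, hx, hx.not_ge]
    · simp [hi, lo, hx, not_lt.1 hx]
  have hhir : ∀ h, ∫⁻ x, hi h x ^ r₀ ∂μ =
      ∫⁻ x, (if ENNReal.ofReal h < f x then f x ^ r₀ else 0) ∂μ := by
    intro h
    congr with x
    simp only [hi]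
    split_ifs <;> simp [hr₀]
  have hlor : ∀ h, ∫⁻ x, lo h x ^ r₁ ∂μ =
      ∫⁻ x, (if f x ≤ ENNReal.ofReal h then f x ^ r₁ else 0) ∂μ := by
    intro h
    congr with x
    simp only [lo]
    split_ifs <;> simp [hr.trans hr1]
  have hFm := hTm f hf
  -- The layer cake is applied to `(T f / 2) ^ (s / r)` with exponent `r`, so that its variable is
  -- the cut height itself. The half is for subadditivity: if `T f` exceeds `2 h ^ (r / s)`, one of
  -- the two parts exceeds `h ^ (r / s)`.
  have main : ENNReal.ofReal (1 / r) * ∫⁻ x, (T f x / 2) ^ s ∂μ ≤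
      ENNReal.ofReal (D * (1 / (r - r₀)) + D * (1 / (r₁ - r))) := by
    calc _ = ∫⁻ x, ENNReal.ofReal (1 / r) * ((T f x / 2) ^ (s / r)) ^ r ∂μ := by
          rw [← lintegral_const_mul' _ _ ENNReal.ofReal_ne_top]
          congr with x
          rw [← ENNReal.rpow_mul, div_mul_cancel₀ _ hr.ne']
      _ = ∫⁻ x, (∫⁻ h in Set.Ioi (0 : ℝ), (if ENNReal.ofReal h < (T f x / 2) ^ (s / r) then
            ENNReal.ofReal (h ^ (r - 1)) else 0)) ∂μ := by
          congr with x
          rw [lintegral_Ioi_rpow_ite_lt hr]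
      _ = ∫⁻ h in Set.Ioi (0 : ℝ), ∫⁻ x, (if ENNReal.ofReal h < (T f x / 2) ^ (s / r) then
            ENNReal.ofReal (h ^ (r - 1)) else 0) ∂μ := by
          refine lintegral_lintegral_swap (Measurable.aemeasurable ?_)
          refine Measurable.ite (measurableSet_lt (by fun_prop) ?_) (by fun_prop) (by fun_prop)
          exact ((hFm.comp measurable_fst).div_const 2).pow_const _
      _ = ∫⁻ h in Set.Ioi (0 : ℝ), ENNReal.ofReal (h ^ (r - 1)) *
            μ {x | ENNReal.ofReal h < (T f x / 2) ^ (s / r)} := by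
          congr with h
          have hm : MeasurableSet {x | ENNReal.ofReal h < (T f x / 2) ^ (s / r)} :=
            measurableSet_lt measurable_const ((hFm.div_const 2).pow_const _)
          rw [← lintegral_indicator_const hm]
          congr with x
          simp [Set.indicator]
      _ ≤ ∫⁻ h in Set.Ioi (0 : ℝ), (ENNReal.ofReal D * (ENNReal.ofReal (h ^ (r - r₀ - 1)) *
            ∫⁻ x, (if ENNReal.ofReal h < f x then f x ^ r₀ else 0) ∂μ) +
            ENNReal.ofReal D * (ENNReal.ofReal (h ^ (r - r₁ - 1)) *
            ∫⁻ x, (if f x ≤ ENNReal.ofReal h then f x ^ r₁ else 0) ∂μ)) := by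
          refine setLIntegral_mono' measurableSet_Ioi fun h hh => ?_
          have hh : 0 < h := hh
          have i₀ := h₀.mul_measure_le hD hr hs hr₀ hrs₀ hrel₀ (hhi h) hh
            ((hhir h).le.trans (lintegral_high_le h0r hf1 hh))
          have i₁ := h₁.mul_measure_le hD hr hs (hr.trans hr1) hrs₁ hrel₁ (hlo h) hh
            ((hlor h).le.trans (lintegral_low_le hr hr1 hf1 hh))
          rw [hhir] at i₀
          rw [hlor] at i₁
          refine le_trans ?_ (add_le_add i₀ i₁)
          rw [← mul_add]
          gcongr
          refine (measure_mono ?_).trans (measure_union_le _ _)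
          intro x hx
          by_contra hcon
          simp only [Set.mem_union, Set.mem_ofPred_eq, not_or, not_lt] at hcon
          refine (not_le_of_gt (show ENNReal.ofReal h < (T f x / 2) ^ (s / r) from hx)) ?_
          have hle : T f x / 2 ≤ ENNReal.ofReal (h ^ (r / s)) := by
            refine ENNReal.div_le_of_le_mul ?_
            rw [mul_two]
            refine le_trans ?_ (add_le_add hcon.1 hcon.2)
            conv_lhs => rw [← hsum h]
            exact hTadd _ _ (hhi h) (hlo h) x
          refine (ENNReal.rpow_le_rpow hle (by positivity)).trans (le_of_eq ?_)
          rw [ENNReal.ofReal_rpow_of_pos (by positivity), ← Real.rpow_mul hh.le,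
            div_mul_div_cancel₀ hs.ne', div_self hr.ne', Real.rpow_one]
      _ ≤ _ := by
          rw [lintegral_add_left', lintegral_const_mul' _ _ ENNReal.ofReal_ne_top,
            lintegral_const_mul' _ _ ENNReal.ofReal_ne_top, ENNReal.ofReal_add (by positivity)
            (by positivity), ENNReal.ofReal_mul hD, ENNReal.ofReal_mul hD]
          · gcongr
            · exact lintegral_Ioi_mul_high_le hf hr₀ h0r hf1
            · exact lintegral_Ioi_mul_low_le hf hr hr1 hf1
          · refine Measurable.aemeasurable ?_
            refine Measurable.const_mul (Measurable.mul (by fun_prop) ?_) _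
            refine Measurable.lintegral_prod_right' (f := fun p : ℝ × α =>
              if ENNReal.ofReal p.1 < f p.2 then f p.2 ^ r₀ else 0) ?_
            exact Measurable.ite (measurableSet_lt (by fun_prop) (by fun_prop)) (by fun_prop)
              (by fun_prop)
  calc ∫⁻ x, T f x ^ s ∂μ = ENNReal.ofReal (2 ^ s * r) * (ENNReal.ofReal (1 / r) *
        ∫⁻ x, (T f x / 2) ^ s ∂μ) := by
        rw [← mul_assoc, ← ENNReal.ofReal_mul (by positivity), mul_assoc,
          mul_one_div_cancel hr.ne', mul_one, ← lintegral_const_mul' _ _ ENNReal.ofReal_ne_top]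
        congr with x
        rw [← ENNReal.ofReal_rpow_of_pos two_pos, ← ENNReal.mul_rpow_of_nonneg _ _ hs.le,
          ENNReal.ofReal_ofNat, ENNReal.mul_div_cancel two_ne_zero ENNReal.ofNat_ne_top]
    _ ≤ ENNReal.ofReal (2 ^ s * r) * ENNReal.ofReal (D * (1 / (r - r₀)) + D * (1 / (r₁ - r))) := by
        gcongr
    _ ≤ _ := by
        rw [← ENNReal.ofReal_mul (by positivity)]
        refine ENNReal.ofReal_le_ofReal ?_
        rw [mul_assoc]
        linarith

end Interpolation

/-! ### Young and Hölder on a group, and weak type of the weighted fractional integral -/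

section WeakTypeBound

/-- Substitute `y ↦ x y`. The inverse stays, since `μ` is only left invariant; this is why growth
bounds for both `φ x` and `φ x⁻¹` are carried along. -/
theorem lintegral_inv_mul_eq {G : Type*} [Group G] [MeasurableSpace G] [MeasurableMul₂ G]
    {μ : Measure G} [μ.IsMulLeftInvariant] (F : G → ℝ≥0∞) (x : G) :
    ∫⁻ y, F (y⁻¹ * x) ∂μ = ∫⁻ y, F y⁻¹ ∂μ := by
  rw [← lintegral_mul_left_eq_self (fun y => F (y⁻¹ * x)) x]
  simp

variable {G : Type*} [Group G] [MeasurableSpace G] [MeasurableMul₂ G] [MeasurableInv G]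
  {μ : Measure G}

theorem lintegral_conv_le_Lp_mul_Lq [μ.IsMulLeftInvariant] {g κ : G → ℝ≥0∞} (hg : Measurable g)
    (hκ : Measurable κ) {r r' : ℝ} (hr : r.HolderConjugate r') (x : G) :
    ∫⁻ y, g y * κ (y⁻¹ * x) ∂μ ≤
      (∫⁻ y, g y ^ r ∂μ) ^ (1 / r) * (∫⁻ y, κ y⁻¹ ^ r' ∂μ) ^ (1 / r') := by
  have hm : Measurable fun y => κ (y⁻¹ * x) := by fun_prop
  have := ENNReal.lintegral_mul_le_Lp_mul_Lq μ hr hg.aemeasurable hm.aemeasurable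
  rwa [lintegral_inv_mul_eq (fun z => κ z ^ r')] at this

/-- Young's inequality `L^r * L^1 ⊆ L^r`, where the kernel is integrable on both sides. -/
theorem lintegral_conv_rpow_le [SFinite μ] [μ.IsMulLeftInvariant] {g κ : G → ℝ≥0∞}
    (hg : Measurable g) (hκ : Measurable κ) {r : ℝ} (hr : 1 < r) {N : ℝ≥0∞}
    (hN : ∫⁻ y, κ y ∂μ ≤ N) (hN' : ∫⁻ y, κ y⁻¹ ∂μ ≤ N) :
    ∫⁻ x, (∫⁻ y, g y * κ (y⁻¹ * x) ∂μ) ^ r ∂μ ≤ N ^ r * ∫⁻ y, g y ^ r ∂μ := by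
  have hr0 : 0 < r := by linarith
  have hc := Real.HolderConjugate.conjExponent hr
  set r' := r.conjExponent
  -- Hölder after writing `κ = κ ^ (1/r) * κ ^ (1/r')`: the second factor integrates to at most a
  -- power of `N`.
  have hpt : ∀ x, (∫⁻ y, g y * κ (y⁻¹ * x) ∂μ) ^ r ≤
      (∫⁻ y, g y ^ r * κ (y⁻¹ * x) ∂μ) * N ^ (r - 1) := by
    intro x
    have hm : Measurable fun y => κ (y⁻¹ * x) := by fun_prop
    have h1 := ENNReal.lintegral_mul_le_Lp_mul_Lq μ hc
      (f := fun y => g y * κ (y⁻¹ * x) ^ (1 / r)) (g := fun y => κ (y⁻¹ * x) ^ (1 / r'))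
      (hg.mul (hm.pow_const _)).aemeasurable (hm.pow_const _).aemeasurable
    have e1 : ∀ y, ((fun y => g y * κ (y⁻¹ * x) ^ (1 / r)) * fun y => κ (y⁻¹ * x) ^ (1 / r')) y =
        g y * κ (y⁻¹ * x) := by
      intro y
      rw [Pi.mul_apply, mul_assoc, ← ENNReal.rpow_add_of_nonneg _ _ hc.one_div_nonneg
        hc.symm.one_div_nonneg]
      simp only [one_div, hc.inv_add_inv_eq_one, ENNReal.rpow_one]
    have e2 : ∀ y, (g y * κ (y⁻¹ * x) ^ (1 / r)) ^ r = g y ^ r * κ (y⁻¹ * x) := by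
      intro y
      rw [ENNReal.mul_rpow_of_nonneg _ _ hr0.le, ← ENNReal.rpow_mul, one_div_mul_cancel hr0.ne',
        ENNReal.rpow_one]
    have e3 : ∀ y, (κ (y⁻¹ * x) ^ (1 / r')) ^ r' = κ (y⁻¹ * x) := by
      intro y
      rw [← ENNReal.rpow_mul, one_div_mul_cancel hc.symm.ne_zero, ENNReal.rpow_one]
    simp only [e1, e2, e3] at h1
    rw [lintegral_inv_mul_eq κ] at h1
    calc _ ≤ ((∫⁻ y, g y ^ r * κ (y⁻¹ * x) ∂μ) ^ (1 / r) * N ^ (1 / r')) ^ r := by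
          refine ENNReal.rpow_le_rpow (h1.trans ?_) hr0.le
          gcongr
          exact hc.symm.one_div_nonneg
      _ = _ := by
          rw [ENNReal.mul_rpow_of_nonneg _ _ hr0.le, ← ENNReal.rpow_mul, ← ENNReal.rpow_mul,
            one_div_mul_cancel hr0.ne', ENNReal.rpow_one]
          congr 2
          rw [one_div, ← hc.one_sub_inv]
          field_simp
  have hm2 : Measurable fun p : G × G => g p.2 ^ r * κ (p.2⁻¹ * p.1) := by fun_prop
  calc _ ≤ ∫⁻ x, (∫⁻ y, g y ^ r * κ (y⁻¹ * x) ∂μ) * N ^ (r - 1) ∂μ := lintegral_mono hpt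
    _ = (∫⁻ x, ∫⁻ y, g y ^ r * κ (y⁻¹ * x) ∂μ ∂μ) * N ^ (r - 1) :=
        lintegral_mul_const _ hm2.lintegral_prod_right'
    _ = (∫⁻ y, ∫⁻ x, g y ^ r * κ (y⁻¹ * x) ∂μ ∂μ) * N ^ (r - 1) := by
        rw [lintegral_lintegral_swap hm2.aemeasurable]
    _ = (∫⁻ y, g y ^ r * ∫⁻ x, κ x ∂μ ∂μ) * N ^ (r - 1) := by
        congr with y
        rw [lintegral_const_mul _ (by fun_prop), lintegral_mul_left_eq_self κ y⁻¹]
    _ = (∫⁻ y, g y ^ r ∂μ) * ((∫⁻ x, κ x ∂μ) * N ^ (r - 1)) := by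
        rw [lintegral_mul_const _ (by fun_prop), mul_assoc]
    _ ≤ (∫⁻ y, g y ^ r ∂μ) * (N ^ (1 : ℝ) * N ^ (r - 1)) := by
        rw [ENNReal.rpow_one]
        gcongr
    _ = _ := by
        rw [← ENNReal.rpow_add_of_nonneg _ _ zero_le_one (by linarith), mul_comm]
        ring_nf

/-- The weighted fractional integral `φ(x)^{-B} ∫ g(y) φ(y⁻¹ x)^{A-1} dy`. -/
noncomputable def fracInt (μ : Measure G) (φ : G → ℝ) (A B : ℝ) (g : G → ℝ≥0∞) (x : G) : ℝ≥0∞ :=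
  ENNReal.ofReal (φ x ^ (-B)) * ∫⁻ y, g y * ENNReal.ofReal (φ (y⁻¹ * x) ^ (-(1 - A))) ∂μ

/-- Cut the kernel at `φ = t`: the near part is controlled off a set of measure `t`, the far part
uniformly, and the weight off `{φ < t}`. The scale `t` stays free, to be fitted to the level later.
-/
theorem exists_measure_lt_fracInt_le [SFinite μ] [μ.IsMulLeftInvariant] {φ : G → ℝ}
    (hφ : Measurable φ) {c : ℝ} (hc0 : 0 ≤ c)
    (hc : ∀ t : ℝ, 0 < t → μ {x | φ x < t} ≤ ENNReal.ofReal (c * t))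
    (hc' : ∀ t : ℝ, 0 < t → μ {x | φ x⁻¹ < t} ≤ ENNReal.ofReal (c * t))
    {r A B : ℝ} (hr : 1 < r) (hA : 0 < A) (hAr : A < 1 / r) (hB : 0 ≤ B) :
    ∃ C : ℝ, 0 < C ∧ ∀ g : G → ℝ≥0∞, Measurable g → ∀ t M : ℝ, 0 < t → 0 < M →
      ∫⁻ y, g y ^ r ∂μ ≤ ENNReal.ofReal (M ^ r) →
      μ {x | ENNReal.ofReal (C * t ^ (A - B - 1 / r) * M) < fracInt μ φ A B g x} ≤
        ENNReal.ofReal (C * t) := by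
  have hr0 : 0 < r := by linarith
  have hA1 : A < 1 := hAr.trans_le ((div_le_one hr0).2 hr.le)
  have hcj := Real.HolderConjugate.conjExponent hr
  set r' := r.conjExponent
  have hr'0 : 0 < r' := hcj.symm.pos
  have hinv : 1 / r' = 1 - 1 / r := by rw [one_div, one_div, hcj.one_sub_inv]
  -- This is `A < 1 / r` rewritten: the far kernel is in `L^{r'}`.
  have hp : 1 < (1 - A) * r' := by
    rw [← div_lt_iff₀ hr'0, hinv]
    linarith
  have hφi : Measurable fun x => φ x⁻¹ := hφ.comp measurable_inv
  obtain ⟨C₁, hC₁, h₁⟩ := setLIntegral_rpow_lt_le hφ hc hc0 (p := 1 - A) (by linarith) (by linarith)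
  obtain ⟨C₂, hC₂, h₂⟩ := setLIntegral_rpow_lt_le hφi hc' hc0 (p := 1 - A) (by linarith) (by linarith)
  obtain ⟨C₃, hC₃, h₃⟩ := setLIntegral_rpow_ge_le hφi hc' hc0 hp
  have hC₃' : 0 < C₃ ^ (1 / r') := by positivity
  refine ⟨C₁ + C₂ + C₃ ^ (1 / r') + c + 1, by positivity, fun g hg t M ht hM hgM => ?_⟩
  have hM' : (∫⁻ y, g y ^ r ∂μ) ^ (1 / r) ≤ ENNReal.ofReal M := by
    refine (ENNReal.rpow_le_rpow hgM (by positivity)).trans (le_of_eq ?_)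
    rw [ENNReal.ofReal_rpow_of_pos (by positivity), ← Real.rpow_mul hM.le,
      mul_one_div_cancel hr0.ne', Real.rpow_one]
  let k (x : G) : ℝ≥0∞ := ENNReal.ofReal (φ x ^ (-(1 - A)))
  have hk : Measurable k := by fun_prop
  let k₁ := {x | φ x < t}.indicator k
  let k₂ := {x | t ≤ φ x}.indicator k
  have hs₁ : MeasurableSet {x | φ x < t} := measurableSet_lt hφ measurable_const
  have hs₂ : MeasurableSet {x | t ≤ φ x} := measurableSet_le measurable_const hφ
  have hk₁ : Measurable k₁ := hk.indicator hs₁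
  have hk₂ : Measurable k₂ := hk.indicator hs₂
  have hk12 : ∀ x, k x = k₁ x + k₂ x := by
    intro x
    by_cases hx : φ x < t
    · simp [k₁, k₂, hx, hx.not_ge]
    · simp [k₁, k₂, hx, not_lt.1 hx]
  set N := (C₁ + C₂) * t ^ A with hNdef
  have hN0 : 0 < N := by positivity
  have htA : 0 < t ^ A := by positivity
  have hN₁ : ∫⁻ y, k₁ y ∂μ ≤ ENNReal.ofReal N := by
    rw [lintegral_indicator hs₁]
    refine (h₁ t ht).trans (ENNReal.ofReal_le_ofReal ?_)
    rw [sub_sub_cancel]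
    nlinarith
  have hN₂ : ∫⁻ y, k₁ y⁻¹ ∂μ ≤ ENNReal.ofReal N := by
    have : ∀ y, k₁ y⁻¹ = {x | φ x⁻¹ < t}.indicator
        (fun y => ENNReal.ofReal (φ y⁻¹ ^ (-(1 - A)))) y := fun y => rfl
    simp only [this]
    rw [lintegral_indicator (measurableSet_lt hφi measurable_const)]
    refine (h₂ t ht).trans (ENNReal.ofReal_le_ofReal ?_)
    rw [sub_sub_cancel]
    nlinarith
  set F₁ : G → ℝ≥0∞ := fun x => ∫⁻ y, g y * k₁ (y⁻¹ * x) ∂μ with hF₁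
  set F₂ : G → ℝ≥0∞ := fun x => ∫⁻ y, g y * k₂ (y⁻¹ * x) ∂μ with hF₂
  have hF₁m : Measurable F₁ := by
    have hm2 : Measurable fun p : G × G => g p.2 * k₁ (p.2⁻¹ * p.1) := by fun_prop
    exact hm2.lintegral_prod_right'
  have hF₁b : ∫⁻ x, F₁ x ^ r ∂μ ≤ ENNReal.ofReal (N ^ r * M ^ r) := by
    refine (lintegral_conv_rpow_le hg hk₁ hr hN₁ hN₂).trans ?_
    rw [ENNReal.ofReal_mul (p := N ^ r) (by positivity), ENNReal.ofReal_rpow_of_pos hN0]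
    gcongr
  have hF₂b : ∀ x, F₂ x ≤ ENNReal.ofReal (C₃ ^ (1 / r') * t ^ (A - 1 / r) * M) := by
    intro x
    refine (lintegral_conv_le_Lp_mul_Lq hg hk₂ hcj x).trans ?_
    have : ∀ y, k₂ y⁻¹ ^ r' = {x | t ≤ φ x⁻¹}.indicator
        (fun y => ENNReal.ofReal (φ y⁻¹ ^ (-((1 - A) * r')))) y := by
      intro y
      by_cases hy : t ≤ φ y⁻¹
      · have hpos : 0 < φ y⁻¹ := ht.trans_le hy
        simp only [k₂, k, Set.indicator, Set.mem_ofPred_eq, hy, if_true]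
        rw [ENNReal.ofReal_rpow_of_pos (by positivity), ← Real.rpow_mul hpos.le, neg_mul]
      · simp [k₂, Set.indicator, hy, hr'0]
    simp only [this]
    rw [lintegral_indicator (measurableSet_le measurable_const hφi), mul_comm, mul_comm _ M,
      ENNReal.ofReal_mul hM.le, mul_comm (ENNReal.ofReal M)]
    refine mul_le_mul' ((ENNReal.rpow_le_rpow (h₃ t ht) (by positivity)).trans (le_of_eq ?_)) hM'
    rw [ENNReal.ofReal_rpow_of_pos (by positivity), Real.mul_rpow hC₃.le (by positivity),
      ← Real.rpow_mul ht.le]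
    congr 3
    rw [sub_mul, one_mul, mul_assoc, mul_one_div_cancel hr'0.ne', hinv]
    ring
  -- The threshold is the one at which Chebyshev with `‖F₁‖_r ≤ N M` returns exactly `t`. As `N` is
  -- of order `t ^ A`, it has the same size as the bound on `F₂`.
  have hcheb : μ {x | ENNReal.ofReal (N * t ^ (-(1 / r)) * M) < F₁ x} ≤ ENNReal.ofReal t := by
    have hb : 0 < N * t ^ (-(1 / r)) * M := by positivity
    have hbr : (N * t ^ (-(1 / r)) * M) ^ r = N ^ r * M ^ r / t := by
      rw [Real.mul_rpow (by positivity) hM.le, Real.mul_rpow hN0.le (by positivity),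
        ← Real.rpow_mul ht.le, neg_mul, one_div_mul_cancel hr0.ne', Real.rpow_neg_one]
      ring
    calc _ ≤ μ {x | ENNReal.ofReal (N * t ^ (-(1 / r)) * M) ^ r ≤ F₁ x ^ r} :=
          measure_mono fun x hx => ENNReal.rpow_le_rpow (le_of_lt hx) hr0.le
      _ ≤ (∫⁻ x, F₁ x ^ r ∂μ) / ENNReal.ofReal (N * t ^ (-(1 / r)) * M) ^ r := by
          refine meas_ge_le_lintegral_div (hF₁m.pow_const _).aemeasurable ?_ ?_
          · exact (ENNReal.rpow_pos (ENNReal.ofReal_pos.2 hb) ENNReal.ofReal_ne_top).ne'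
          · exact ENNReal.rpow_ne_top_of_nonneg hr0.le ENNReal.ofReal_ne_top
      _ ≤ ENNReal.ofReal (N ^ r * M ^ r) / ENNReal.ofReal (N ^ r * M ^ r / t) := by
          rw [ENNReal.ofReal_rpow_of_pos hb, hbr]
          gcongr
      _ = _ := by
          rw [← ENNReal.ofReal_div_of_pos (by positivity)]
          congr 1
          field_simp
  calc _ ≤ μ ({x | φ x < t} ∪ {x | ENNReal.ofReal (N * t ^ (-(1 / r)) * M) < F₁ x}) := by
        refine measure_mono fun x hx => ?_
        by_contra hcon
        simp only [Set.mem_union, Set.mem_ofPred_eq, not_or, not_lt] at hcon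
        refine (not_le_of_gt (show _ < fracInt μ φ A B g x from hx)) ?_
        have hsplit : ∫⁻ y, g y * ENNReal.ofReal (φ (y⁻¹ * x) ^ (-(1 - A))) ∂μ = F₁ x + F₂ x := by
          rw [← lintegral_add_left (by fun_prop)]
          congr with y
          rw [← mul_add, ← hk12]
        have hw : φ x ^ (-B) ≤ t ^ (-B) :=
          Real.rpow_le_rpow_of_nonpos ht hcon.1 (neg_nonpos.2 hB)
        rw [fracInt, hsplit]
        calc _ ≤ ENNReal.ofReal (t ^ (-B)) * (ENNReal.ofReal (N * t ^ (-(1 / r)) * M) +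
              ENNReal.ofReal (C₃ ^ (1 / r') * t ^ (A - 1 / r) * M)) := by
              gcongr
              · exact hcon.2
              · exact hF₂b x
          _ = ENNReal.ofReal ((C₁ + C₂ + C₃ ^ (1 / r')) * t ^ (A - B - 1 / r) * M) := by
              rw [← ENNReal.ofReal_add (by positivity) (by positivity),
                ← ENNReal.ofReal_mul (by positivity)]
              congr 1
              have q1 : t ^ (A - B - 1 / r) = t ^ (-B) * t ^ (A - 1 / r) := by
                rw [← Real.rpow_add ht]; ring_nf
              have q2 : t ^ (A - 1 / r) = t ^ A * t ^ (-(1 / r)) := by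
                rw [← Real.rpow_add ht]; ring_nf
              rw [q1, hNdef, q2]
              ring
          _ ≤ _ := by
              refine ENNReal.ofReal_le_ofReal ?_
              exact mul_le_mul_of_nonneg_right
                (mul_le_mul_of_nonneg_right (by linarith) (by positivity)) hM.le
    _ ≤ ENNReal.ofReal (c * t) + ENNReal.ofReal t :=
        (measure_union_le _ _).trans (add_le_add (hc t ht) hcheb)
    _ ≤ _ := by
        rw [← ENNReal.ofReal_add (by positivity) ht.le]
        refine ENNReal.ofReal_le_ofReal ?_
        have : 0 ≤ (C₁ + C₂ + C₃ ^ (1 / r')) * t := by positivity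
        linarith

/-- The relation between the exponents says `A - B - 1/r = -1/s`, so the level reached at scale `t`
is `C M t^(-1/s)`; solve for `t`. -/
theorem exists_weakType_fracInt [SFinite μ] [μ.IsMulLeftInvariant] {φ : G → ℝ}
    (hφ : Measurable φ) {c : ℝ} (hc0 : 0 ≤ c)
    (hc : ∀ t : ℝ, 0 < t → μ {x | φ x < t} ≤ ENNReal.ofReal (c * t))
    (hc' : ∀ t : ℝ, 0 < t → μ {x | φ x⁻¹ < t} ≤ ENNReal.ofReal (c * t))
    {r s A B : ℝ} (hr : 1 < r) (hA : 0 < A) (hAr : A < 1 / r) (hB : 0 ≤ B) (hs : 0 < s)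
    (hrel : 1 / s = 1 / r - A + B) :
    ∃ D : ℝ, 0 < D ∧ WeakType μ (fracInt μ φ A B) r s D := by
  have hr0 : 0 < r := by linarith
  obtain ⟨C, hC, h⟩ := exists_measure_lt_fracInt_le hφ hc0 hc hc' hr hA hAr hB
  have key : ∀ g : G → ℝ≥0∞, Measurable g → ∀ l M : ℝ, 0 < l → 0 < M →
      ∫⁻ y, g y ^ r ∂μ ≤ ENNReal.ofReal (M ^ r) →
      μ {x | ENNReal.ofReal l < fracInt μ φ A B g x} ≤
        ENNReal.ofReal (C * C ^ s * l ^ (-s) * M ^ s) := by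
    intro g hg l M hl hM hgM
    -- This `t` solves `C * t ^ (-1/s) * M = l`.
    have := h g hg ((C * M / l) ^ s) M (by positivity) hM hgM
    have e1 : C * ((C * M / l) ^ s) ^ (A - B - 1 / r) * M = l := by
      rw [← Real.rpow_mul (by positivity), show A - B - 1 / r = -(1 / s) by linarith, mul_neg,
        mul_one_div_cancel hs.ne', Real.rpow_neg_one]
      field_simp
    have e2 : C * (C * M / l) ^ s = C * C ^ s * l ^ (-s) * M ^ s := by
      rw [Real.div_rpow (by positivity) hl.le, Real.mul_rpow hC.le hM.le, Real.rpow_neg hl.le]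
      ring
    rwa [e1, e2] at this
  refine ⟨C * C ^ s, by positivity, fun g hg l hl => ?_⟩
  have hpos : 0 < C * C ^ s * l ^ (-s) := by positivity
  rcases eq_or_ne (∫⁻ y, g y ^ r ∂μ) ⊤ with hT | hT
  · rw [hT, ENNReal.top_rpow_of_pos (by positivity), ENNReal.mul_top (by simpa using hpos)]
    exact le_top
  rcases eq_or_ne (∫⁻ y, g y ^ r ∂μ) 0 with hZ | hZ
  · rw [hZ, ENNReal.zero_rpow_of_pos (by positivity), mul_zero]
    -- `key` needs `M > 0`, so for a null `g` let `M = 1 / (n + 1)` tend to zero.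
    refine ge_of_tendsto' (x := Filter.atTop)
      (f := fun n : ℕ => ENNReal.ofReal (C * C ^ s * l ^ (-s) * (1 / ((n : ℝ) + 1)) ^ s)) ?_
      fun n => key g hg l _ hl (by positivity) (by rw [hZ]; exact bot_le)
    have h0 := (tendsto_one_div_add_atTop_nhds_zero_nat (𝕜 := ℝ)).rpow_const (p := s)
      (Or.inr hs.le)
    rw [Real.zero_rpow hs.ne'] at h0
    have := h0.const_mul (C * C ^ s * l ^ (-s))
    rw [mul_zero] at this
    simpa using ENNReal.tendsto_ofReal this
  · have hI := ENNReal.toReal_pos hZ hT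
    set I := (∫⁻ y, g y ^ r ∂μ).toReal with hIdef
    have hIe : ∫⁻ y, g y ^ r ∂μ = ENNReal.ofReal I := (ENNReal.ofReal_toReal hT).symm
    have := key g hg l (I ^ (1 / r)) hl (by positivity) (by
      rw [← Real.rpow_mul hI.le, one_div_mul_cancel hr0.ne', Real.rpow_one, hIe])
    rw [hIe, ENNReal.ofReal_rpow_of_pos hI, ← ENNReal.ofReal_mul hpos.le]
    rwa [← Real.rpow_mul hI.le, one_div_mul_eq_div] at this

end WeakTypeBound

/-! ### The Stein-Weiss inequality, for nonnegative functions and then for convolutions -/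

section SteinWeiss

variable {G : Type*} [Group G] [MeasurableSpace G] [MeasurableMul₂ G] [MeasurableInv G]
  {μ : Measure G}

theorem measurable_fracInt [SFinite μ] {φ : G → ℝ} (hφ : Measurable φ) (A B : ℝ)
    {g : G → ℝ≥0∞} (hg : Measurable g) : Measurable (fracInt μ φ A B g) := by
  have hm2 : Measurable fun p : G × G =>
    g p.2 * ENNReal.ofReal (φ (p.2⁻¹ * p.1) ^ (-(1 - A))) := by fun_prop
  have := hm2.lintegral_prod_right' (ν := μ)
  unfold fracInt
  fun_prop

theorem fracInt_add {φ : G → ℝ} (hφ : Measurable φ) (A B : ℝ)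
    {f g : G → ℝ≥0∞} (hf : Measurable f) (x : G) :
    fracInt μ φ A B (f + g) x = fracInt μ φ A B f x + fracInt μ φ A B g x := by
  rw [fracInt, fracInt, fracInt, ← mul_add, ← lintegral_add_left (by fun_prop)]
  simp only [Pi.add_apply, add_mul]

theorem fracInt_const_mul {G : Type*} [Group G] [MeasurableSpace G] {μ : Measure G} {φ : G → ℝ} (A B : ℝ) {c : ℝ≥0∞} (hc : c ≠ ⊤) (g : G → ℝ≥0∞) (x : G) :
    fracInt μ φ A B (fun y => c * g y) x = c * fracInt μ φ A B g x := by
  rw [fracInt, fracInt, mul_left_comm, ← lintegral_const_mul' _ _ hc]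
  simp only [mul_assoc]

theorem WeakType.mono {α : Type*} [MeasurableSpace α] {ν : Measure α}
    {T : (α → ℝ≥0∞) → α → ℝ≥0∞} {r s D D' : ℝ} (h : WeakType ν T r s D) (hD : D ≤ D') :
    WeakType ν T r s D' := by
  intro g hg l hl
  refine (h g hg l hl).trans ?_
  gcongr

/-- The Stein-Weiss inequality for nonnegative functions: weighted fractional integration is
bounded from `L^r` to `L^s`. -/
theorem exists_lintegral_fracInt_rpow_le [SFinite μ] [μ.IsMulLeftInvariant] {φ : G → ℝ}
    (hφ : Measurable φ) {c : ℝ} (hc0 : 0 ≤ c)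
    (hc : ∀ t : ℝ, 0 < t → μ {x | φ x < t} ≤ ENNReal.ofReal (c * t))
    (hc' : ∀ t : ℝ, 0 < t → μ {x | φ x⁻¹ < t} ≤ ENNReal.ofReal (c * t))
    {r s A B : ℝ} (hr : 1 < r) (hrs : r ≤ s) (hA : 0 < A) (hAr : A < 1 / r) (hB : 0 ≤ B)
    (hrel : A = 1 / r - 1 / s + B) :
    ∃ C : ℝ, 0 < C ∧ ∀ g : G → ℝ≥0∞, Measurable g →
      ∫⁻ x, fracInt μ φ A B g x ^ s ∂μ ≤ ENNReal.ofReal C * (∫⁻ y, g y ^ r ∂μ) ^ (s / r) := by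
  have hr0 : 0 < r := by linarith
  have hs0 : 0 < s := by linarith
  -- Equivalent to `r ≤ s`; it gives `q ≤ p` at every endpoint, as the interpolation requires.
  have hBA : B ≤ A := by
    have := one_div_le_one_div_of_le hr0 hrs
    linarith
  -- With `A` and `B` fixed, all `q` in `(1, 1/A)` give weak type on one line. The interval is open
  -- and contains `r`; the midpoints of its two halves serve as endpoints.
  have hend : ∀ q : ℝ, 1 < q → A < 1 / q → ∃ p D : ℝ, q ≤ p ∧ 1 / r - 1 / s = 1 / q - 1 / p ∧
      0 < D ∧ WeakType μ (fracInt μ φ A B) q p D := by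
    intro q hq hAq
    have hp : 0 < 1 / q - A + B := by linarith
    obtain ⟨D, hD, h⟩ := exists_weakType_fracInt hφ hc0 hc hc' hq hA hAq hB
      (s := 1 / (1 / q - A + B)) (by positivity) (by rw [one_div_one_div])
    refine ⟨_, D, ?_, ?_, hD, h⟩
    · rw [le_one_div (by linarith) hp]
      linarith
    · rw [one_div_one_div]
      linarith
  have hrA : r < 1 / A := by rwa [lt_one_div hr0 hA]
  obtain ⟨s₀, D₀, hrs₀, hrel₀, hD₀, hw₀⟩ := hend ((1 + r) / 2) (by linarith)
    (hAr.trans (one_div_lt_one_div_of_lt (by linarith) (by linarith)))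
  obtain ⟨s₁, D₁, hrs₁, hrel₁, hD₁, hw₁⟩ := hend ((r + 1 / A) / 2) (by linarith)
    (by rw [lt_one_div hA (by linarith)]; linarith)
  obtain ⟨C, hC, h⟩ := exists_lintegral_rpow_le_of_weakType (μ := μ)
    (fun g hg => measurable_fracInt hφ A B hg)
    (fun f g hf _ x => (fracInt_add hφ A B hf x).le) (D := D₀ + D₁) (by positivity) hs0
    (by linarith) (by linarith) (by linarith) hrs₀ hrs₁ hrel₀ hrel₁ (hw₀.mono (by linarith))
    (hw₁.mono (by linarith))
  refine ⟨C, hC, fun g hg => ?_⟩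
  rcases eq_or_ne (∫⁻ y, g y ^ r ∂μ) ⊤ with hT | hT
  · rw [hT, ENNReal.top_rpow_of_pos (by positivity), ENNReal.mul_top (by simpa using hC)]
    exact le_top
  rcases eq_or_ne (∫⁻ y, g y ^ r ∂μ) 0 with hZ | hZ
  · have hg0 : ∀ᵐ y ∂μ, g y = 0 := by
      rw [lintegral_eq_zero_iff (by fun_prop)] at hZ
      filter_upwards [hZ] with y hy
      simpa [hr0, hr0.not_gt] using hy
    have hx : ∀ x, fracInt μ φ A B g x = 0 := by
      intro x
      rw [fracInt, lintegral_congr_ae (g := 0)]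
      · simp
      · filter_upwards [hg0] with y hy
        simp [hy]
    simp [hx, hs0]
  set I := ∫⁻ y, g y ^ r ∂μ with hI
  have hIr0 : I ^ (1 / r) ≠ 0 := by simp [hZ, hT]
  have hIrT : I ^ (1 / r) ≠ ⊤ := ENNReal.rpow_ne_top_of_nonneg (by positivity) hT
  have ha : (I ^ (1 / r))⁻¹ ≠ ⊤ := ENNReal.inv_ne_top.2 hIr0
  -- Normalise `g` to unit norm and use homogeneity; this is where `I` must be neither `0` nor `⊤`.
  have h1 := h (fun y => (I ^ (1 / r))⁻¹ * g y) (hg.const_mul _) (by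
    simp only [ENNReal.mul_rpow_of_nonneg _ _ hr0.le]
    rw [lintegral_const_mul' _ _ (ENNReal.rpow_ne_top_of_nonneg hr0.le ha), ENNReal.inv_rpow,
      ← ENNReal.rpow_mul, one_div_mul_cancel hr0.ne', ENNReal.rpow_one, ← hI,
      ENNReal.inv_mul_cancel hZ hT])
  simp only [fracInt_const_mul A B ha, ENNReal.mul_rpow_of_nonneg _ _ hs0.le] at h1
  rw [lintegral_const_mul' _ _ (ENNReal.rpow_ne_top_of_nonneg hs0.le ha), ENNReal.inv_rpow,
    ← ENNReal.rpow_mul, one_div_mul_eq_div, mul_comm, ← div_eq_mul_inv] at h1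
  exact (ENNReal.div_le_iff (by simp [hZ, hT]) (ENNReal.rpow_ne_top_of_nonneg (by positivity) hT)).1 h1

/-- Absolute values reduce everything to `fracInt` of `|f|`; finiteness of the resulting norm gives
a.e. absolute convergence as well. -/
theorem exists_eLpNorm_groupConv_div_le [SFinite μ] [μ.IsMulLeftInvariant] {φ : G → ℝ}
    (hφ : Measurable φ) (hφ0 : ∀ x, 0 ≤ φ x) {c : ℝ} (hc0 : 0 ≤ c)
    (hc : ∀ t : ℝ, 0 < t → μ {x | φ x < t} ≤ ENNReal.ofReal (c * t))
    (hc' : ∀ t : ℝ, 0 < t → μ {x | φ x⁻¹ < t} ≤ ENNReal.ofReal (c * t))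
    {r s A B : ℝ} (hr : 1 < r) (hrs : r ≤ s) (hA : 0 < A) (hAr : A < 1 / r) (hB : 0 ≤ B)
    (hrel : A = 1 / r - 1 / s + B) :
    ∃ C₁ : ℝ, 0 < C₁ ∧ ∀ (C₀ : ℝ) (k : G → ℂ), 0 < C₀ → AEStronglyMeasurable k μ →
      (∀ᵐ x ∂μ, ‖k x‖ ≤ C₀ * φ x ^ (A - 1)) →
      ∀ f : G → ℂ, MemLp f (ENNReal.ofReal r) μ →
        (∀ᵐ x ∂μ, Integrable (fun y => f y * k (y⁻¹ * x)) μ) ∧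
        MemLp (fun x => groupConv μ f k x / ((φ x ^ B : ℝ) : ℂ)) (ENNReal.ofReal s) μ ∧
        eLpNorm (fun x => groupConv μ f k x / ((φ x ^ B : ℝ) : ℂ)) (ENNReal.ofReal s) μ ≤
          ENNReal.ofReal (C₀ * C₁) * eLpNorm f (ENNReal.ofReal r) μ := by
  have hr0 : 0 < r := by linarith
  have hs0 : 0 < s := by linarith
  obtain ⟨C, hC, h⟩ := exists_lintegral_fracInt_rpow_le hφ hc0 hc hc' hr hrs hA hAr hB hrel
  refine ⟨C ^ (1 / s), by positivity, fun C₀ k hC₀ hk hkb f hf => ?_⟩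
  have hfe : AEMeasurable (fun y => ‖f y‖ₑ) μ := hf.aestronglyMeasurable.enorm
  set g : G → ℝ≥0∞ := hfe.mk _ with hg
  have hgm : Measurable g := hfe.measurable_mk
  have hfg : (fun y => ‖f y‖ₑ) =ᵐ[μ] g := hfe.ae_eq_mk
  -- Null sets survive inversion and right translation, so the a.e. kernel bound and a.e.
  -- measurability pass to `y ↦ k (y⁻¹ * x)` for every `x`.
  have hqmp : ∀ x, Measure.QuasiMeasurePreserving (fun y : G => y⁻¹ * x) μ μ := fun x =>
    (quasiMeasurePreserving_mul_right μ x).comp (quasiMeasurePreserving_inv μ)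
  have hbound : ∀ x, ∫⁻ y, ‖f y * k (y⁻¹ * x)‖ₑ ∂μ ≤
      ENNReal.ofReal C₀ * ∫⁻ y, g y * ENNReal.ofReal (φ (y⁻¹ * x) ^ (-(1 - A))) ∂μ := by
    intro x
    rw [← lintegral_const_mul' _ _ ENNReal.ofReal_ne_top]
    refine lintegral_mono_ae ?_
    filter_upwards [hfg, (hqmp x).ae hkb] with y hy hky
    rw [enorm_mul, ← hy, mul_left_comm, ← ENNReal.ofReal_mul hC₀.le]
    gcongr
    rw [← ofReal_norm, neg_sub]
    exact ENNReal.ofReal_le_ofReal hky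
  have hLr : eLpNorm f (ENNReal.ofReal r) μ = (∫⁻ y, g y ^ r ∂μ) ^ (1 / r) := by
    rw [eLpNorm_eq_lintegral_rpow_enorm_toReal (by simpa using hr0) ENNReal.ofReal_ne_top,
      ENNReal.toReal_ofReal hr0.le]
    congr 1
    refine lintegral_congr_ae ?_
    filter_upwards [hfg] with y hy
    rw [hy]
  have hgT : ∫⁻ y, g y ^ r ∂μ ≠ ⊤ := by
    have := hf.2.ne
    rw [hLr] at this
    contrapose! this
    rw [this, ENNReal.top_rpow_of_pos (by positivity)]
  have hTfin : ∫⁻ x, fracInt μ φ A B g x ^ s ∂μ ≠ ⊤ :=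
    ((h g hgm).trans_lt (ENNReal.mul_lt_top ENNReal.ofReal_lt_top
      (ENNReal.rpow_lt_top_of_nonneg (by positivity) hgT))).ne
  have hmeas : AEStronglyMeasurable (fun x => groupConv μ f k x / ((φ x ^ B : ℝ) : ℂ)) μ := by
    have h1 : AEStronglyMeasurable (fun p : G × G => f p.2 * k (p.2⁻¹ * p.1)) (μ.prod μ) :=
      hf.aestronglyMeasurable.comp_snd.mul
        (hk.comp_quasiMeasurePreserving (quasiMeasurePreserving_inv_mul_swap μ μ))
    have h2 := h1.integral_prod_right'
    have h3 : AEStronglyMeasurable (fun x => (((φ x ^ B)⁻¹ : ℝ) : ℂ)) μ := by fun_prop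
    refine (h2.mul h3).congr (Filter.Eventually.of_forall fun x => ?_)
    simp [groupConv, div_eq_mul_inv]
  have hnorm : eLpNorm (fun x => groupConv μ f k x / ((φ x ^ B : ℝ) : ℂ)) (ENNReal.ofReal s) μ ≤
      ENNReal.ofReal (C₀ * C ^ (1 / s)) * eLpNorm f (ENNReal.ofReal r) μ := by
    rw [hLr, eLpNorm_eq_lintegral_rpow_enorm_toReal (by simpa using hs0) ENNReal.ofReal_ne_top,
      ENNReal.toReal_ofReal hs0.le]
    calc _ ≤ (∫⁻ x, (ENNReal.ofReal C₀ * fracInt μ φ A B g x) ^ s ∂μ) ^ (1 / s) := by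
          gcongr with x
          rw [div_eq_mul_inv, enorm_mul, fracInt, mul_left_comm, mul_comm, ← Complex.ofReal_inv,
            Real.rpow_neg (hφ0 x)]
          refine mul_le_mul' (le_of_eq ?_) ((enorm_integral_le_lintegral_enorm _).trans (hbound x))
          rw [← ofReal_norm, Complex.norm_real, Real.norm_of_nonneg]
          exact inv_nonneg.2 (Real.rpow_nonneg (hφ0 x) _)
      _ = ENNReal.ofReal C₀ * (∫⁻ x, fracInt μ φ A B g x ^ s ∂μ) ^ (1 / s) := by
          simp only [ENNReal.mul_rpow_of_nonneg _ _ hs0.le]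
          rw [lintegral_const_mul' _ _ (ENNReal.rpow_ne_top_of_nonneg hs0.le ENNReal.ofReal_ne_top),
            ENNReal.mul_rpow_of_nonneg _ _ (by positivity), ← ENNReal.rpow_mul,
            mul_one_div_cancel hs0.ne', ENNReal.rpow_one]
      _ ≤ ENNReal.ofReal C₀ *
          (ENNReal.ofReal C * (∫⁻ y, g y ^ r ∂μ) ^ (s / r)) ^ (1 / s) := by
          gcongr
          exact h g hgm
      _ = _ := by
          rw [ENNReal.mul_rpow_of_nonneg _ _ (by positivity), ← ENNReal.rpow_mul,
            ENNReal.ofReal_rpow_of_pos hC, ← mul_assoc, ← ENNReal.ofReal_mul hC₀.le,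
            div_mul_div_cancel₀' hs0.ne']
  refine ⟨?_, ⟨hmeas, hnorm.trans_lt (ENNReal.mul_lt_top ENNReal.ofReal_lt_top hf.2)⟩, hnorm⟩
  -- Finiteness of `fracInt` at `x` bounds the unweighted integral only if the weight is nonzero,
  -- and at `φ x = 0` its value may be `0`.
  have hpos : ∀ᵐ x ∂μ, 0 < φ x := by
    rw [ae_iff]
    simpa using measure_nonpos_eq_zero hc
  filter_upwards [ae_lt_top ((measurable_fracInt hφ A B hgm).pow_const s) hTfin, hpos]
    with x hx hx0
  refine ⟨hf.aestronglyMeasurable.mul (hk.comp_quasiMeasurePreserving (hqmp x)), ?_⟩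
  refine (hbound x).trans_lt (ENNReal.mul_lt_top ENNReal.ofReal_lt_top ?_)
  by_contra hcon
  rw [not_lt_top_iff] at hcon
  rw [fracInt, hcon, ENNReal.mul_top (by simpa using Real.rpow_pos_of_pos hx0 _),
    ENNReal.top_rpow_of_pos hs0] at hx
  exact lt_irrefl _ hx

end SteinWeiss

/-! ### Functions with values `ρ ^ n` on the shells of a filtration -/

section GeometricFiltration

variable {G : Type*} {F : ℤ → Set G} {φ : G → ℝ} {ρ : ℝ}

theorem exists_mem_diff_of_not_mem (hF : Antitone F) (hU : ∀ x, ∃ n, x ∈ F n) {x : G} {m : ℤ}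
    (hx : x ∉ F m) : ∃ n, x ∈ F n ∧ x ∉ F (n + 1) := by
  obtain ⟨n, hn, hmax⟩ := Int.exists_greatest_of_bdd (P := fun n => x ∈ F n)
    ⟨m, fun z hz => le_of_lt (lt_of_not_ge fun hmz => hx (hF hmz hz))⟩ (hU x)
  exact ⟨n, hn, fun h => by have := hmax _ h; omega⟩

theorem eq_of_mem_diff (hF : Antitone F) {x : G} {m n : ℤ} (hm : x ∈ F m) (hm' : x ∉ F (m + 1))
    (hn : x ∈ F n) (hn' : x ∉ F (n + 1)) : m = n := by
  by_contra hne
  rcases lt_or_gt_of_ne hne with h | h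
  · exact hm' (hF (show m + 1 ≤ n by omega) hn)
  · exact hn' (hF (show n + 1 ≤ m by omega) hm)

/-- `φ` takes only the values `0` and `ρ ^ n`, so a level in `(ρ ^ (m+1), ρ ^ m]` cuts between
consecutive shells. Measurability and growth of `φ` both follow from this. -/
theorem sublevel_eq_of_filtration (hF : Antitone F) (hU : ∀ x, ∃ n, x ∈ F n) (hρ : 0 < ρ)
    (hρ1 : ρ < 1) (hφ : ∀ x n, x ∈ F n → x ∉ F (n + 1) → φ x = ρ ^ n)
    (hφ0 : ∀ x, (∀ n, x ∈ F n) → φ x = 0) {t : ℝ} {m : ℤ} (h1 : ρ ^ (m + 1) < t) (h2 : t ≤ ρ ^ m) :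
    {x | φ x < t} = F (m + 1) := by
  ext x
  simp only [Set.mem_ofPred_eq]
  have hanti : StrictAnti fun n : ℤ => ρ ^ n := zpow_right_strictAnti₀ hρ hρ1
  by_cases hx : ∀ n, x ∈ F n
  · rw [hφ0 x hx]
    exact ⟨fun _ => hx _, fun _ => (zpow_pos hρ _).trans h1⟩
  push Not at hx
  obtain ⟨j, hj⟩ := hx
  obtain ⟨n, hn, hn'⟩ := exists_mem_diff_of_not_mem hF hU hj
  rw [hφ x n hn hn']
  constructor
  · intro h
    have : m < n := hanti.lt_iff_gt.1 (h.trans_le h2)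
    exact hF (show m + 1 ≤ n by omega) hn
  · intro h
    have : m + 1 ≤ n := by
      by_contra hcon
      exact hn' (hF (show n + 1 ≤ m + 1 by omega) h)
    exact (hanti.antitone this).trans_lt h1

theorem exists_zpow_succ_lt_le (hρ : 0 < ρ) (hρ1 : ρ < 1) {t : ℝ} (ht : 0 < t) :
    ∃ m : ℤ, ρ ^ (m + 1) < t ∧ t ≤ ρ ^ m := by
  obtain ⟨n, h1, h2⟩ := exists_mem_Ioc_zpow ht ((one_lt_inv₀ hρ).2 hρ1)
  refine ⟨-n - 1, ?_, ?_⟩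
  · simpa using h1
  · rwa [show -n - 1 = -(n + 1) by ring, zpow_neg, ← inv_zpow]

variable [MeasurableSpace G]

theorem measurable_of_filtration (hF : Antitone F) (hU : ∀ x, ∃ n, x ∈ F n) (hρ : 0 < ρ)
    (hρ1 : ρ < 1) (hφ : ∀ x n, x ∈ F n → x ∉ F (n + 1) → φ x = ρ ^ n)
    (hφ0 : ∀ x, (∀ n, x ∈ F n) → φ x = 0) (hnn : ∀ x, 0 ≤ φ x) (hm : ∀ n, MeasurableSet (F n)) :
    Measurable φ := by
  refine measurable_of_Iio fun t => ?_
  rcases le_or_gt t 0 with ht | ht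
  · convert MeasurableSet.empty
    ext x
    simpa using ht.trans (hnn x)
  · obtain ⟨m, h1, h2⟩ := exists_zpow_succ_lt_le hρ hρ1 ht
    have := sublevel_eq_of_filtration hF hU hρ hρ1 hφ hφ0 h1 h2
    change MeasurableSet {x | φ x < t}
    rw [this]
    exact hm _

/-- The sublevel set is `F (m + 1)`, and `ρ ^ (m + 1) < t`. The factor `1 + κ` is one constant good
for `F` and its inverses. -/
theorem measure_sublevel_le_of_filtration [Group G] {μ : Measure G} (hF : Antitone F)
    (hU : ∀ x, ∃ n, x ∈ F n) (hρ : 0 < ρ) (hρ1 : ρ < 1)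
    (hφ : ∀ x n, x ∈ F n → x ∉ F (n + 1) → φ x = ρ ^ n)
    (hφ0 : ∀ x, (∀ n, x ∈ F n) → φ x = 0) {κ : ℝ} (hκ : 0 ≤ κ)
    (hμ : ∀ n, μ (F n) = ENNReal.ofReal (ρ ^ n))
    (hμ' : ∀ n, μ (F n)⁻¹ = ENNReal.ofReal (κ * ρ ^ n)) {t : ℝ} (ht : 0 < t) :
    μ {x | φ x < t} ≤ ENNReal.ofReal ((1 + κ) * t) ∧
      μ {x | φ x⁻¹ < t} ≤ ENNReal.ofReal ((1 + κ) * t) := by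
  obtain ⟨m, h1, h2⟩ := exists_zpow_succ_lt_le hρ hρ1 ht
  have hS := sublevel_eq_of_filtration hF hU hρ hρ1 hφ hφ0 h1 h2
  have hκt : 0 ≤ κ * t := by positivity
  constructor
  · rw [hS, hμ]
    exact ENNReal.ofReal_le_ofReal (by linarith)
  · have : {x | φ x⁻¹ < t} = (F (m + 1))⁻¹ := by
      rw [← hS]
      rfl
    rw [this, hμ']
    refine ENNReal.ofReal_le_ofReal ?_
    nlinarith

end GeometricFiltration

/-! ### Dilations as automorphisms of the Lie algebra and of the group -/

section Dilation

variable {K 𝔤 : Type*} [Field K] [LieRing 𝔤] [LieAlgebra K 𝔤]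

theorem map_nestedBracket {L L' : Type*} [LieRing L] [LieRing L'] (f : L → L')
    (h0 : f 0 = 0) (hf : ∀ x y, f ⁅x, y⁆ = ⁅f x, f y⁆) :
    ∀ l : List L, f (nestedBracket l) = nestedBracket (l.map f)
  | [] => by simpa [nestedBracket] using h0
  | [x] => by simp [nestedBracket]
  | x :: y :: l => by
    have := map_nestedBracket f h0 hf (y :: l)
    rw [List.map_cons] at this
    simp [nestedBracket, hf, this]

theorem map_dynkinWord {L L' : Type*} [LieRing L] [LieRing L'] (f : L → L') (x y : L) {k : ℕ}
    (p : Fin k → ℕ × ℕ) : (dynkinWord x y p).map f = dynkinWord (f x) (f y) p := by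
  simp [dynkinWord, List.map_flatten, List.map_ofFn, Function.comp_def]

/-- The product is a `K`-linear combination of iterated brackets. Nothing else about the
Baker-Campbell-Hausdorff formula is needed. -/
theorem map_bch (f : 𝔤 →ₗ[K] 𝔤) (hf : ∀ x y, f ⁅x, y⁆ = ⁅f x, f y⁆) (x y : 𝔤) :
    f (bch K x y) = bch K (f x) (f y) := by
  simp only [bch, dynkinSum, map_sum, map_smul, map_nestedBracket f (map_zero f) hf, map_dynkinWord]

variable (V : ℕ → Submodule K 𝔤) [GradedLieAlgebra V]

theorem dilation_of_mem (γ : K) {k : ℕ} {v : 𝔤} (hv : v ∈ V k) : dilation V γ v = γ ^ k • v := by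
  simp only [dilation, LinearMap.comp_apply, LinearEquiv.coe_coe,
    DirectSum.decomposeLinearEquiv_apply, DirectSum.decompose_of_mem V hv]
  exact (DirectSum.toModule_lof K k _).trans (by simp)

theorem dilation_lie (γ : K) (x y : 𝔤) :
    dilation V γ ⁅x, y⁆ = ⁅dilation V γ x, dilation V γ y⁆ := by
  induction x using DirectSum.Decomposition.inductionOn V with
  | zero => simp
  | add x x' hx hx' => simp [hx, hx']
  | homogeneous x =>
    induction y using DirectSum.Decomposition.inductionOn V with
    | zero => simp
    | add y y' hy hy' => simp [hy, hy']
    | homogeneous y =>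
      rw [dilation_of_mem V γ x.2, dilation_of_mem V γ y.2,
        dilation_of_mem V γ (SetLike.GradedBracket.bracket_mem x.2 y.2), smul_lie, lie_smul,
        smul_smul, pow_add]

theorem dilation_mul (γ γ' : K) (x : 𝔤) :
    dilation V (γ * γ') x = dilation V γ (dilation V γ' x) := by
  induction x using DirectSum.Decomposition.inductionOn V with
  | zero => simp
  | add x x' hx hx' => simp [hx, hx']
  | homogeneous x =>
    rw [dilation_of_mem V _ x.2, dilation_of_mem V _ x.2, map_smul, dilation_of_mem V _ x.2,
      smul_smul, mul_pow, mul_comm]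

theorem dilation_one (x : 𝔤) : dilation V (1 : K) x = x := by
  induction x using DirectSum.Decomposition.inductionOn V with
  | zero => simp
  | add x x' hx hx' => simp [hx, hx']
  | homogeneous x => rw [dilation_of_mem V _ x.2, one_pow, one_smul]

theorem repr_dilation {ι : Type*} [Fintype ι] (X : Module.Basis ι K 𝔤) {d : ι → ℕ}
    (hd : ∀ i, X i ∈ V (d i)) (γ : K) (v : 𝔤) (i : ι) :
    X.repr (dilation V γ v) i = γ ^ d i * X.repr v i := by
  classical
  conv_lhs => rw [← X.sum_repr v]
  simp only [map_sum, map_smul, dilation_of_mem V γ (hd _), smul_smul, Finsupp.finsetSum_apply,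
    Finsupp.smul_apply, Module.Basis.repr_self]
  rw [Finset.sum_eq_single i]
  · simp [mul_comm]
  · intro j _ hj
    simp [hj]
  · simp

variable {V} {G : Type*} [TopologicalSpace 𝔤] [Group G] [TopologicalSpace G]

/-- The automorphism of the group with which the exponential map intertwines a dilation. -/
noncomputable def dilationEquiv (e : LieExp K 𝔤 G) (V : ℕ → Submodule K 𝔤) [GradedLieAlgebra V]
    {γ : K} (hγ : γ ≠ 0) : G ≃* G where
  toFun x := e.toHomeomorph (dilation V γ (e.toHomeomorph.symm x))
  invFun x := e.toHomeomorph (dilation V γ⁻¹ (e.toHomeomorph.symm x))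
  left_inv x := by simp [← dilation_mul, hγ, dilation_one]
  right_inv x := by simp [← dilation_mul, hγ, dilation_one]
  map_mul' x y := by
    obtain ⟨x, rfl⟩ := e.toHomeomorph.surjective x
    obtain ⟨y, rfl⟩ := e.toHomeomorph.surjective y
    have h := fun x y => e.exp_mul_exp x y
    change ∀ x y, e.toHomeomorph x * e.toHomeomorph y = e.toHomeomorph (bch K x y) at h
    simp only [h, Homeomorph.symm_apply_apply, map_bch _ (dilation_lie V γ)]

end Dilation

/-! ### Second countability and denominators in a local field -/

section LocalField

variable {K : Type*} [Field K] [ValuativeRel K] [TopologicalSpace K] [IsNonarchimedeanLocalField K]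

/-- A rank one valuation makes `K` a normed field; being locally compact it is proper, hence second
countable. Measurability on `G × G` and uniqueness of Haar measure rely on this. -/
theorem secondCountableTopology_of_localField : SecondCountableTopology K := by
  let := IsTopologicalAddGroup.rightUniformSpace K
  have := isUniformAddGroup_of_addCommGroup (G := K)
  let : (Valued.v (R := K)).RankOne :=
  { hom' := ValuativeRel.IsRankLeOne.nonempty.some.emb (R := K).comp
      MonoidWithZeroHom.ValueGroup₀.embedding
    strictMono' := ValuativeRel.IsRankLeOne.nonempty.some.strictMono.comp
        MonoidWithZeroHom.ValueGroup₀.embedding_strictMono }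
  open scoped Valued in
  have : ProperSpace K := .of_nontriviallyNormedField_of_weaklyLocallyCompactSpace K
  infer_instance

theorem exists_pow_mul_mem_integer {ϖ : 𝒪[K]} (hϖ : Irreducible ϖ) (c : K) :
    ∃ n : ℕ, (ϖ : K) ^ n * c ∈ 𝒪[K] := by
  rcases le_total (ValuativeRel.valuation K c) 1 with h | h
  · exact ⟨0, by simpa [Valuation.mem_integer_iff] using h⟩
  have hc : c ≠ 0 := by
    rintro rfl
    simp at h
  have hi : c⁻¹ ∈ 𝒪[K] := by
    rw [Valuation.mem_integer_iff, map_inv₀]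
    exact inv_le_one_of_one_le₀ h
  obtain ⟨n, u, hu⟩ := IsDiscreteValuationRing.eq_unit_mul_pow_irreducible
    (x := (⟨c⁻¹, hi⟩ : 𝒪[K])) (by simpa [Subtype.ext_iff] using hc) hϖ
  refine ⟨n, ?_⟩
  have h1 : c⁻¹ = (u : 𝒪[K]) * (ϖ : K) ^ n := by simpa using congrArg Subtype.val hu
  have h2 : ((u⁻¹ : 𝒪[K]ˣ) : K) * ((u : 𝒪[K]) : K) = 1 := by
    rw [← Subring.coe_mul, Units.inv_mul, Subring.coe_one]
  have h3 : (ϖ : K) ^ n * c = ((u⁻¹ : 𝒪[K]ˣ) : 𝒪[K]) := by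
    calc (ϖ : K) ^ n * c = ((u⁻¹ : 𝒪[K]ˣ) : K) * ((u : 𝒪[K]) * (ϖ : K) ^ n) * c := by
          rw [← mul_assoc, h2, one_mul]
      _ = _ := by rw [← h1, mul_assoc, inv_mul_cancel₀ hc, mul_one]
  rw [h3]
  exact Subtype.prop _

end LocalField

/-! ### The sets `Gₙ` in coordinates -/

section Filtration

variable {K : Type*} [Field K] [ValuativeRel K] {𝔤 : Type*} [LieRing 𝔤] [LieAlgebra K 𝔤]
  {ι : Type*} (X : Module.Basis ι K 𝔤)

theorem basis_mem_lattice (i : ι) : X i ∈ lattice X := by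
  classical
  intro j
  rw [Module.Basis.repr_self, Finsupp.single_apply]
  split_ifs
  · exact one_mem _
  · exact zero_mem _

variable [TopologicalSpace 𝔤] {G : Type*} [Group G] [TopologicalSpace G] (e : LieExp K 𝔤 G)
  (V : ℕ → Submodule K 𝔤) [GradedLieAlgebra V] {ϖ : 𝒪[K]}

theorem filtration_zero : filtration e V X ϖ 0 = e.toHomeomorph '' lattice X := by
  simp [filtration, dilation_one]

/-- The basis vectors are eigenvectors of the dilations, so in coordinates `Gₙ` is the box with
sides `ϖ ^ (n * d i) 𝒪`. -/
theorem mem_filtration_iff [Fintype ι] {d : ι → ℕ} (hd : ∀ i, X i ∈ V (d i)) (hϖ : (ϖ : K) ≠ 0) (n : ℤ)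
    (x : G) : x ∈ filtration e V X ϖ n ↔
      ∀ i, ((ϖ : K) ^ (-n)) ^ d i * X.repr (e.toHomeomorph.symm x) i ∈ 𝒪[K] := by
  have hn : (ϖ : K) ^ n ≠ 0 := zpow_ne_zero _ hϖ
  constructor
  · rintro ⟨v, hv, rfl⟩ i
    simp only [Homeomorph.symm_apply_apply, repr_dilation V X hd, ← mul_assoc, ← mul_pow,
      zpow_neg, inv_mul_cancel₀ hn, one_pow, one_mul]
    exact hv i
  · intro h
    refine ⟨dilation V ((ϖ : K) ^ (-n)) (e.toHomeomorph.symm x), fun i => ?_, ?_⟩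
    · rw [repr_dilation V X hd]
      exact h i
    · dsimp only
      rw [← dilation_mul, ← zpow_add₀ hϖ, add_neg_cancel, zpow_zero, dilation_one,
        Homeomorph.apply_symm_apply]

theorem image_filtration (hϖ : (ϖ : K) ≠ 0) (n : ℤ) :
    dilationEquiv e V hϖ '' filtration e V X ϖ n = filtration e V X ϖ (n + 1) := by
  rw [filtration, filtration, Set.image_image]
  congr! 2 with v
  change e.toHomeomorph (dilation V _ (e.toHomeomorph.symm (e.toHomeomorph _))) = _
  rw [Homeomorph.symm_apply_apply, ← dilation_mul, add_comm, zpow_add₀ hϖ, zpow_one]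

theorem antitone_filtration [Fintype ι] {d : ι → ℕ} (hd : ∀ i, X i ∈ V (d i)) (hϖ : (ϖ : K) ≠ 0) :
    Antitone (filtration e V X ϖ) := by
  refine antitone_int_of_succ_le fun n x hx => ?_
  rw [mem_filtration_iff X e V hd hϖ] at hx ⊢
  intro i
  have h1 : (ϖ : K) ^ (-n) = ϖ * (ϖ : K) ^ (-(n + 1)) := by
    rw [← zpow_one_add₀ hϖ]
    congr 1
    ring
  rw [h1, mul_pow, mul_assoc]
  exact mul_mem (pow_mem ϖ.2 _) (hx i)

theorem exists_mem_filtration [TopologicalSpace K] [IsNonarchimedeanLocalField K] [Fintype ι]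
    {d : ι → ℕ} (hd : ∀ i, X i ∈ V (d i)) (hd0 : ∀ i, d i ≠ 0)
    (hϖ : Irreducible ϖ) (x : G) : ∃ n, x ∈ filtration e V X ϖ n := by
  have hϖ0 : (ϖ : K) ≠ 0 := by simpa using hϖ.ne_zero
  choose n hn using fun i => exists_pow_mul_mem_integer hϖ (X.repr (e.toHomeomorph.symm x) i)
  -- Every weight `d i` is at least one, so the largest exponent clears all denominators.
  refine ⟨-((Finset.univ.sup n : ℕ) : ℤ), ?_⟩
  rw [mem_filtration_iff X e V hd hϖ0]
  intro i
  rw [neg_neg, zpow_natCast, ← pow_mul]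
  have hle : n i ≤ Finset.univ.sup n * d i :=
    (Finset.le_sup (Finset.mem_univ i)).trans (Nat.le_mul_of_pos_right _ (Nat.pos_of_ne_zero (hd0 i)))
  obtain ⟨m, hm⟩ := Nat.exists_eq_add_of_le' hle
  rw [hm, pow_add, mul_assoc]
  exact mul_mem (pow_mem ϖ.2 _) (hn i)

/-- Membership would put `ϖ ^ (-d i)` in `𝒪`, making `ϖ` a unit. This strictness of `G₁ ⊂ G₀` yields
`ρ < 1`; a basis vector of weight zero would not give it. -/
theorem exp_basis_notMem_filtration_one [Fintype ι] {d : ι → ℕ} (hd : ∀ i, X i ∈ V (d i))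
    (hd0 : ∀ i, d i ≠ 0) (hϖ : Irreducible ϖ) (i : ι) :
    e.toHomeomorph (X i) ∉ filtration e V X ϖ 1 := by
  have hϖ0 : (ϖ : K) ≠ 0 := by simpa using hϖ.ne_zero
  rw [mem_filtration_iff X e V hd hϖ0]
  intro h
  have h1 := h i
  simp only [Homeomorph.symm_apply_apply, Module.Basis.repr_self, Finsupp.single_eq_same, mul_one,
    zpow_neg, zpow_one, inv_pow] at h1
  refine hϖ.not_isUnit ((isUnit_pow_iff (hd0 i)).1 (IsUnit.of_mul_eq_one ⟨_, h1⟩ ?_))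
  refine Subtype.ext ?_
  simp [hϖ0]

end Filtration

/-! ### Dilations and Haar measure -/

section DilationTopology

variable {K 𝔤 : Type*} [Field K] [TopologicalSpace K] [LieRing 𝔤] [LieAlgebra K 𝔤]
  [TopologicalSpace 𝔤] [IsModuleTopology K 𝔤] {G : Type*} [Group G] [TopologicalSpace G]
  (e : LieExp K 𝔤 G) (V : ℕ → Submodule K 𝔤) [GradedLieAlgebra V]

theorem continuous_dilation (γ : K) : Continuous (dilation V γ) := by
  have := IsModuleTopology.toContinuousAdd K 𝔤
  have := IsModuleTopology.toContinuousSMul K 𝔤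
  exact IsModuleTopology.continuous_of_linearMap _

theorem continuous_dilationEquiv {γ : K} (hγ : γ ≠ 0) : Continuous (dilationEquiv e V hγ) :=
  e.toHomeomorph.continuous.comp ((continuous_dilation V γ).comp e.toHomeomorph.symm.continuous)

theorem continuous_dilationEquiv_symm {γ : K} (hγ : γ ≠ 0) :
    Continuous (dilationEquiv e V hγ).symm :=
  e.toHomeomorph.continuous.comp ((continuous_dilation V γ⁻¹).comp e.toHomeomorph.symm.continuous)

/-- A dilation of the group, as a homeomorphism. -/
noncomputable def dilationHomeomorph {γ : K} (hγ : γ ≠ 0) : G ≃ₜ G where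
  toEquiv := (dilationEquiv e V hγ).toEquiv
  continuous_toFun := continuous_dilationEquiv e V hγ
  continuous_invFun := continuous_dilationEquiv_symm e V hγ

/-- A dilation multiplies the Haar measure by a constant. -/
theorem exists_measure_image_dilationEquiv [LocallyCompactSpace G] [SecondCountableTopology G]
    [IsTopologicalGroup G] [MeasurableSpace G] [BorelSpace G] {μ : Measure G} [μ.IsHaarMeasure] {γ : K} (hγ : γ ≠ 0) :
    ∃ c : NNReal, ∀ S : Set G, μ (dilationEquiv e V hγ '' S) = c * μ S := by
  -- The push-forward under a topological automorphism is again a Haar measure, so uniqueness leaves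
  -- only a scalar.
  have hH : (μ.map (dilationEquiv e V hγ).symm).IsHaarMeasure :=
    (dilationEquiv e V hγ).symm.isHaarMeasure_map μ (continuous_dilationEquiv_symm e V hγ)
      (continuous_dilationEquiv e V hγ)
  refine ⟨(μ.map (dilationEquiv e V hγ).symm).haarScalarFactor μ, fun S => ?_⟩
  have hmap : μ.map (dilationEquiv e V hγ).symm S = μ (dilationEquiv e V hγ '' S) := by
    have hm := (dilationHomeomorph e V hγ).symm.measurableEmbedding.map_apply μ S
    refine hm.trans (congrArg μ ?_)
    exact ((dilationEquiv e V hγ).toEquiv.image_eq_preimage_symm S).symm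
  rw [← hmap]
  exact DFunLike.congr_fun
    (Measure.isMulLeftInvariant_eq_smul (μ.map (dilationEquiv e V hγ).symm) μ) S

end DilationTopology

/-! ### Topology of the lattice and of the group, from coordinates -/

section LatticeTopology

variable {K : Type*} [Field K] [ValuativeRel K] [TopologicalSpace K] [IsNonarchimedeanLocalField K]
  {𝔤 : Type*} [LieRing 𝔤] [LieAlgebra K 𝔤] [TopologicalSpace 𝔤] [IsModuleTopology K 𝔤]

/-- The coordinates with respect to a basis, as a homeomorphism. -/
noncomputable def coordHomeomorph {ι : Type*} [Fintype ι] (X : Module.Basis ι K 𝔤) :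
    𝔤 ≃ₜ (ι → K) where
  toEquiv := X.equivFun.toEquiv
  continuous_toFun := IsModuleTopology.continuous_of_linearMap X.equivFun.toLinearMap
  continuous_invFun := by
    have := IsModuleTopology.toContinuousAdd K 𝔤
    have := IsModuleTopology.toContinuousSMul K 𝔤
    exact IsModuleTopology.continuous_of_linearMap X.equivFun.symm.toLinearMap

theorem lattice_eq_preimage {ι : Type*} [Fintype ι] (X : Module.Basis ι K 𝔤) :
    lattice X = coordHomeomorph X ⁻¹' Set.univ.pi fun _ => (𝒪[K] : Set K) := by
  ext v
  simp only [Set.mem_preimage, Set.mem_pi, Set.mem_univ, true_imp_iff]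
  rfl

theorem isCompact_lattice {ι : Type*} [Fintype ι] (X : Module.Basis ι K 𝔤) :
    IsCompact (lattice X) := by
  rw [lattice_eq_preimage, Homeomorph.isCompact_preimage]
  exact isCompact_univ_pi fun _ => IsNonarchimedeanLocalField.isCompact_closedBall K 1

theorem isOpen_lattice {ι : Type*} [Fintype ι] (X : Module.Basis ι K 𝔤) : IsOpen (lattice X) := by
  rw [lattice_eq_preimage, Homeomorph.isOpen_preimage]
  exact isOpen_set_pi Set.finite_univ fun _ _ => Valuation.isOpen_integer

theorem isClosed_lattice {ι : Type*} [Fintype ι] (X : Module.Basis ι K 𝔤) :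
    IsClosed (lattice X) := by
  rw [lattice_eq_preimage, Homeomorph.isClosed_preimage]
  exact isClosed_set_pi fun _ _ => Valuation.isClosed_integer

end LatticeTopology

section LocalFieldCoordinates

variable {K : Type*} [Field K] [ValuativeRel K] [TopologicalSpace K] [IsNonarchimedeanLocalField K]
  {ι : Type*} [Finite ι] {G : Type*} [TopologicalSpace G]

theorem secondCountableTopology_of_homeomorph (h : G ≃ₜ (ι → K)) : SecondCountableTopology G := by
  have := secondCountableTopology_of_localField (K := K)
  exact h.secondCountableTopology

theorem locallyCompactSpace_of_homeomorph (h : G ≃ₜ (ι → K)) : LocallyCompactSpace G :=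
  h.isOpenEmbedding.locallyCompactSpace

end LocalFieldCoordinates


/-- Since `ρ > 0`, the recursion can also be run backwards. -/
theorem eq_ofReal_zpow_of_succ {a : ℤ → ℝ≥0∞} {ρ κ : ℝ} (hρ : 0 < ρ)
    (h0 : a 0 = ENNReal.ofReal κ) (hs : ∀ n, a (n + 1) = ENNReal.ofReal ρ * a n) (n : ℤ) :
    a n = ENNReal.ofReal (κ * ρ ^ n) := by
  induction n using Int.induction_on with
  | zero => simpa using h0
  | succ n ih =>
    rw [hs, ih, ← ENNReal.ofReal_mul hρ.le, zpow_add_one₀ hρ.ne']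
    congr 1
    ring
  | pred n ih =>
    have h := hs (-(n : ℤ) - 1)
    rw [sub_add_cancel, ih] at h
    have hρ' : ENNReal.ofReal ρ ≠ 0 := by simpa using hρ
    rw [← ENNReal.mul_right_inj hρ' ENNReal.ofReal_ne_top, ← h, ← ENNReal.ofReal_mul hρ.le,
      zpow_sub_one₀ hρ.ne']
    congr 1
    field_simp

/-! ### Measures of `Gₙ` and of its inverse -/

section FiltrationMeasure

variable {K : Type*} [Field K] [ValuativeRel K] [TopologicalSpace K] [IsNonarchimedeanLocalField K]
  {𝔤 : Type*} [LieRing 𝔤] [LieAlgebra K 𝔤] [TopologicalSpace 𝔤] [IsModuleTopology K 𝔤]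
  {ι : Type*} [Fintype ι] (X : Module.Basis ι K 𝔤) {G : Type*} [TopologicalSpace G]

variable [Group G] (e : LieExp K 𝔤 G)
variable (V : ℕ → Submodule K 𝔤) [GradedLieAlgebra V] {ϖ : 𝒪[K]}

theorem isCompact_filtration_zero : IsCompact (filtration e V X ϖ 0) := by
  rw [filtration_zero]
  exact (isCompact_lattice X).image e.toHomeomorph.continuous

theorem isClopen_filtration (hϖ : (ϖ : K) ≠ 0) (n : ℤ) : IsClopen (filtration e V X ϖ n) := by
  have hstep : ∀ n : ℤ, IsClopen (filtration e V X ϖ (n + 1)) ↔ IsClopen (filtration e V X ϖ n) := by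
    intro n
    rw [← image_filtration X e V hϖ n]
    exact and_congr (dilationHomeomorph e V hϖ).isClosed_image
      (dilationHomeomorph e V hϖ).isOpen_image
  induction n using Int.induction_on with
  | zero =>
    rw [filtration_zero]
    exact ⟨e.toHomeomorph.isClosed_image.2 (isClosed_lattice X),
      e.toHomeomorph.isOpen_image.2 (isOpen_lattice X)⟩
  | succ n ih => exact (hstep _).2 ih
  | pred n ih =>
    have := hstep (-(n : ℤ) - 1)
    rw [sub_add_cancel] at this
    exact this.1 ih

variable [IsTopologicalGroup G] [MeasurableSpace G] [BorelSpace G] {μ : Measure G}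
  [μ.IsHaarMeasure]

/-- The sets `Gₙ` and their inverses have geometric measures. -/
theorem exists_measure_filtration_eq [Nonempty ι] {d : ι → ℕ} (hd : ∀ i, X i ∈ V (d i))
    (hd0 : ∀ i, d i ≠ 0) (hϖ : Irreducible ϖ) (hμ : μ (filtration e V X ϖ 0) = 1) :
    ∃ ρ κ : ℝ, 0 < ρ ∧ ρ < 1 ∧ 0 ≤ κ ∧
      (∀ n, μ (filtration e V X ϖ n) = ENNReal.ofReal (ρ ^ n)) ∧
      ∀ n, μ (filtration e V X ϖ n)⁻¹ = ENNReal.ofReal (κ * ρ ^ n) := by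
  have hϖ0 : (ϖ : K) ≠ 0 := by simpa using hϖ.ne_zero
  have := secondCountableTopology_of_homeomorph (e.toHomeomorph.symm.trans (GradedKLie.coordHomeomorph X))
  have := locallyCompactSpace_of_homeomorph (e.toHomeomorph.symm.trans (GradedKLie.coordHomeomorph X))
  obtain ⟨c, hc⟩ := exists_measure_image_dilationEquiv e V (μ := μ) hϖ0
  have hc' : (c : ℝ≥0∞) = ENNReal.ofReal c := (ENNReal.ofReal_coe_nnreal).symm
  have hs : ∀ n, μ (filtration e V X ϖ (n + 1)) =
      ENNReal.ofReal c * μ (filtration e V X ϖ n) := fun n => by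
    rw [← image_filtration X e V hϖ0 n, hc, hc']
  -- An automorphism commutes with inversion, so the inverse sets scale by the same factor.
  have hs' : ∀ n, μ (filtration e V X ϖ (n + 1))⁻¹ =
      ENNReal.ofReal c * μ (filtration e V X ϖ n)⁻¹ := fun n => by
    rw [← image_filtration X e V hϖ0 n, ← hc', ← hc]
    congr 1
    ext x
    simp only [Set.mem_inv, Set.mem_image]
    constructor
    · rintro ⟨y, hy, hyx⟩
      exact ⟨y⁻¹, by simpa using hy, by rw [map_inv, hyx, inv_inv]⟩
    · rintro ⟨y, hy, rfl⟩
      exact ⟨y⁻¹, hy, map_inv _ _⟩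
  have h1 : μ (filtration e V X ϖ 1) = ENNReal.ofReal c := by
    have := hs 0
    rwa [hμ, mul_one, zero_add] at this
  have hanti := antitone_filtration X e V hd hϖ0
  have hcl := isClopen_filtration X e V hϖ0
  obtain ⟨i⟩ := ‹Nonempty ι›
  have hcpos : (0 : ℝ) < c := by
    have hne : (filtration e V X ϖ 1).Nonempty := by
      obtain ⟨x, hx⟩ : (filtration e V X ϖ 0).Nonempty := by
        rw [filtration_zero]
        exact ⟨_, X i, basis_mem_lattice X i, rfl⟩
      have := image_filtration X e V hϖ0 0
      rw [zero_add] at this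
      rw [← this]
      exact ⟨_, x, hx, rfl⟩
    have := (hcl 1).isOpen.measure_pos μ hne
    rw [h1] at this
    simpa using this
  -- `G₀ \ G₁` is open and contains `exp (X i)`, hence has positive measure.
  have hc1 : (c : ℝ) < 1 := by
    have hsub : filtration e V X ϖ 1 ⊆ filtration e V X ϖ 0 := hanti zero_le_one
    have hpos : 0 < μ (filtration e V X ϖ 0 \ filtration e V X ϖ 1) := by
      refine ((hcl 0).isOpen.sdiff (hcl 1).isClosed).measure_pos μ ⟨e.toHomeomorph (X i), ?_, ?_⟩
      · rw [filtration_zero]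
        exact ⟨_, basis_mem_lattice X i, rfl⟩
      · exact exp_basis_notMem_filtration_one X e V hd hd0 hϖ i
    have hsum := measure_sdiff_add_inter (μ := μ) (filtration e V X ϖ 0) (hcl 1).isOpen.measurableSet
    rw [Set.inter_eq_self_of_subset_right hsub, hμ, h1] at hsum
    have : ENNReal.ofReal c < 1 := by
      rw [← hsum]
      conv_lhs => rw [← zero_add (ENNReal.ofReal c)]
      exact ENNReal.add_lt_add_right ENNReal.ofReal_ne_top hpos
    simpa using this
  have hfin : μ (filtration e V X ϖ 0)⁻¹ ≠ ⊤ :=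
    (isCompact_filtration_zero X e V).inv.measure_lt_top.ne
  -- Taking `κ = |G₀⁻¹|`, finite by compactness, avoids any appeal to unimodularity.
  refine ⟨c, (μ (filtration e V X ϖ 0)⁻¹).toReal, hcpos, hc1, ENNReal.toReal_nonneg,
    fun n => ?_, fun n => ?_⟩
  · rw [eq_ofReal_zpow_of_succ (κ := 1) hcpos (a := fun n => μ (filtration e V X ϖ n))
      (by simpa using hμ) hs, one_mul]
  · exact eq_ofReal_zpow_of_succ hcpos
      (a := fun n => μ (filtration e V X ϖ n)⁻¹) (ENNReal.ofReal_toReal hfin).symm hs' n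

end FiltrationMeasure

theorem nonempty_of_homDim_ne_zero {K 𝔤 : Type*} [Field K] [LieRing 𝔤] [LieAlgebra K 𝔤]
    {V : ℕ → Submodule K 𝔤} {ι : Type*} (X : Module.Basis ι K 𝔤) (hQ : homDim V ≠ 0) : Nonempty ι := by
  by_contra hι
  rw [not_nonempty_iff] at hι
  have : Subsingleton 𝔤 := X.repr.toEquiv.subsingleton
  refine hQ ?_
  simp [homDim, Module.finrank_zero_of_subsingleton]

/-! ### The quasi-norm raised to the homogeneous dimension -/

section QuasiNorm

variable {K 𝔤 : Type*} [Field K] [LieRing 𝔤] [LieAlgebra K 𝔤] [ValuativeRel K]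
  [TopologicalSpace 𝔤] {G : Type*} [Group G] [TopologicalSpace G] [MeasurableSpace G]
  {μ : Measure G} {e : LieExp K 𝔤 G} {V : ℕ → Submodule K 𝔤} [GradedLieAlgebra V]
  {ι : Type*} {X : Module.Basis ι K 𝔤} {ϖ : 𝒪[K]}

theorem quasiNorm_nonneg (x : G) : 0 ≤ quasiNorm μ e V X ϖ x := by
  unfold quasiNorm
  split_ifs
  · positivity
  · exact le_rfl

/-- In a decreasing filtration a point lies in at most one shell, so the index chosen in `quasiNorm`
is `n`; the exponents `1 / Q` and `Q` cancel. -/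
theorem quasiNorm_rpow_homDim (hF : Antitone (filtration e V X ϖ)) (hQ : 0 < (homDim V : ℝ))
    {ρ : ℝ} (hρ : 0 < ρ) (hμ : ∀ n, μ (filtration e V X ϖ n) = ENNReal.ofReal (ρ ^ n)) {x : G}
    {n : ℤ} (hx : x ∈ filtration e V X ϖ n) (hx' : x ∉ filtration e V X ϖ (n + 1)) :
    quasiNorm μ e V X ϖ x ^ (homDim V : ℝ) = ρ ^ n := by
  have h : ∃ n : ℤ, x ∈ filtration e V X ϖ n ∧ x ∉ filtration e V X ϖ (n + 1) := ⟨n, hx, hx'⟩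
  have hn : h.choose = n := eq_of_mem_diff hF h.choose_spec.1 h.choose_spec.2 hx hx'
  have hpos : 0 < ρ ^ n := zpow_pos hρ n
  rw [quasiNorm, dif_pos h, hn, measureReal_def, hμ, ENNReal.toReal_ofReal hpos.le,
    ← Real.rpow_mul hpos.le, one_div_mul_cancel hQ.ne', Real.rpow_one]

theorem quasiNorm_rpow_homDim_of_forall_mem (hQ : 0 < (homDim V : ℝ)) {x : G}
    (hx : ∀ n, x ∈ filtration e V X ϖ n) : quasiNorm μ e V X ϖ x ^ (homDim V : ℝ) = 0 := by
  rw [quasiNorm, dif_neg (fun ⟨n, hn⟩ => hn.2 (hx _)), Real.zero_rpow hQ.ne']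

end QuasiNorm

end GradedKLie

/-! ### The theorem -/

theorem mainTheorem10
    {K : Type*} [Field K] [ValuativeRel K] [TopologicalSpace K] [IsNonarchimedeanLocalField K]
    -- a graded nilpotent Lie algebra `𝔤 = V 1 ⊕ V 2 ⊕ ⋯` over `K`, with its canonical topology
    {𝔤 : Type*} [LieRing 𝔤] [LieAlgebra K 𝔤] [Module.Finite K 𝔤] [LieRing.IsNilpotent 𝔤]
    [TopologicalSpace 𝔤] [IsModuleTopology K 𝔤]
    (V : ℕ → Submodule K 𝔤) [GradedLieAlgebra V] (hV : V 0 = ⊥)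
    -- the denominators of the Baker-Campbell-Hausdorff product are invertible in `K`
    (hchar : ∀ n : ℕ, 1 ≤ n → n ≤ LieModule.nilpotencyLength 𝔤 𝔤 → (n : K) ≠ 0)
    -- its Lie group
    {G : Type*} [Group G] [TopologicalSpace G] [IsTopologicalGroup G]
    [MeasurableSpace G] [BorelSpace G] (e : GradedKLie.LieExp K 𝔤 G)
    -- a basis of eigenvectors of the dilations, a uniformizer, and the normalized Haar measure
    {ι : Type*} [Fintype ι] (X : Module.Basis ι K 𝔤) (hX : ∀ i, ∃ k, X i ∈ V k)
    (ϖ : 𝒪[K]) (hϖ : Irreducible ϖ)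
    (μ : Measure G) [μ.IsHaarMeasure] (hμ : μ (GradedKLie.filtration e V X ϖ 0) = 1)
    (r s b : ℝ) (a : ℂ) (hr : 1 < r) (hrs : r ≤ s)
    (ha : 0 < a.re) (haQ : a.re < (GradedKLie.homDim V : ℝ) / r)
    (hb : 0 ≤ b) (hbQ : b < (GradedKLie.homDim V : ℝ))
    (hrel : a.re / (GradedKLie.homDim V : ℝ) =
      1 / r - 1 / s + b / (s * (GradedKLie.homDim V : ℝ))) :
    ∃ C₁ : ℝ, 0 < C₁ ∧
      ∀ (C₀ : ℝ) (k : G → ℂ), 0 < C₀ → AEStronglyMeasurable k μ →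
        (∀ x : G, x ≠ 1 →
          ‖k x‖ ≤ C₀ * GradedKLie.quasiNorm μ e V X ϖ x ^
            (a.re - (GradedKLie.homDim V : ℝ))) →
        ∀ f : G → ℂ, MemLp f (ENNReal.ofReal r) μ →
          (∀ᵐ x ∂μ, Integrable (fun y => f y * k (y⁻¹ * x)) μ) ∧
          MemLp (fun x => GradedKLie.groupConv μ f k x /
            ((GradedKLie.quasiNorm μ e V X ϖ x ^ (b / s) : ℝ) : ℂ)) (ENNReal.ofReal s) μ ∧
          eLpNorm (fun x => GradedKLie.groupConv μ f k x /
              ((GradedKLie.quasiNorm μ e V X ϖ x ^ (b / s) : ℝ) : ℂ)) (ENNReal.ofReal s) μ ≤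
            ENNReal.ofReal (C₀ * C₁) * eLpNorm f (ENNReal.ofReal r) μ := by
  have hQ : 0 < (GradedKLie.homDim V : ℝ) := hb.trans_lt hbQ
  have hϖ0 : (ϖ : K) ≠ 0 := by simpa using hϖ.ne_zero
  have hs : 0 < s := by linarith
  have := GradedKLie.secondCountableTopology_of_homeomorph (e.toHomeomorph.symm.trans (GradedKLie.coordHomeomorph X))
  have := GradedKLie.locallyCompactSpace_of_homeomorph (e.toHomeomorph.symm.trans (GradedKLie.coordHomeomorph X))
  have : Nonempty ι := GradedKLie.nonempty_of_homDim_ne_zero (V := V) X (by exact_mod_cast hQ.ne')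
  choose d hd using hX
  have hd0 : ∀ i, d i ≠ 0 := by
    intro i hi
    have := hd i
    rw [hi, hV, Submodule.mem_bot] at this
    exact X.ne_zero i this
  obtain ⟨ρ, κ, hρ, hρ1, hκ, hF, hF'⟩ :=
    GradedKLie.exists_measure_filtration_eq X e V (μ := μ) hd hd0 hϖ hμ
  have hanti := GradedKLie.antitone_filtration X e V hd hϖ0
  have hU := GradedKLie.exists_mem_filtration X e V hd hd0 hϖ
  set N := GradedKLie.quasiNorm μ e V X ϖ with hN
  set Q := (GradedKLie.homDim V : ℝ) with hQdef
  have hN0 : ∀ x, 0 ≤ N x := GradedKLie.quasiNorm_nonneg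
  -- The power `Q` makes sublevel sets grow linearly in measure, which removes `Q` from the
  -- analysis.
  let φ : G → ℝ := fun x => N x ^ Q
  have hφ0 : ∀ x, 0 ≤ φ x := fun x => Real.rpow_nonneg (hN0 x) _
  have hφn : ∀ x n, x ∈ GradedKLie.filtration e V X ϖ n → x ∉ GradedKLie.filtration e V X ϖ (n + 1) →
      φ x = ρ ^ n := fun x n => GradedKLie.quasiNorm_rpow_homDim hanti hQ hρ hF
  have hφz : ∀ x, (∀ n, x ∈ GradedKLie.filtration e V X ϖ n) → φ x = 0 := fun x =>
    GradedKLie.quasiNorm_rpow_homDim_of_forall_mem hQ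
  have hφm : Measurable φ := GradedKLie.measurable_of_filtration hanti hU hρ hρ1 hφn hφz hφ0
    fun n => (GradedKLie.isClopen_filtration X e V hϖ0 n).isOpen.measurableSet
  have hc := fun (t : ℝ) (ht : 0 < t) =>
    GradedKLie.measure_sublevel_le_of_filtration (μ := μ) hanti hU hρ hρ1 hφn hφz hκ hF hF' ht
  obtain ⟨C₁, hC₁, h⟩ := GradedKLie.exists_eLpNorm_groupConv_div_le (μ := μ) hφm hφ0
    (c := 1 + κ) (by positivity) (fun t ht => (hc t ht).1) (fun t ht => (hc t ht).2) hr hrs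
    (A := a.re / Q) (B := b / (s * Q)) (by positivity)
    (by rw [div_lt_iff₀ hQ, one_div_mul_eq_div]; exact haQ) (by positivity) hrel
  have e1 : ∀ x, φ x ^ (a.re / Q - 1) = N x ^ (a.re - Q) := by
    intro x
    rw [← Real.rpow_mul (hN0 x)]
    congr 1
    field_simp
  have e2 : ∀ x, φ x ^ (b / (s * Q)) = N x ^ (b / s) := by
    intro x
    rw [← Real.rpow_mul (hN0 x)]
    congr 1
    field_simp
  simp only [e1, e2] at h
  -- The point `exp 0` lies in every `Gₙ`, so it is null; left translation carries this to the
  -- identity, without identifying the two points.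
  have hone : ∀ᵐ x ∂μ, x ≠ 1 := by
    have h0 : μ {e.toHomeomorph 0} = 0 := by
      refine measure_mono_null ?_ (GradedKLie.measure_nonpos_eq_zero fun t ht => (hc t ht).1)
      rintro x rfl
      refine (hφz _ fun n => ?_).le
      rw [GradedKLie.mem_filtration_iff X e V hd hϖ0]
      simp
    rw [← measure_preimage_mul μ (e.toHomeomorph 0)] at h0
    rw [ae_iff]
    convert h0 using 2
    ext x
    simp
  refine ⟨C₁, hC₁, fun C₀ k hC₀ hk hkb f hf => h C₀ k hC₀ hk ?_ f hf⟩
  filter_upwards [hone] with x hx using hkb x hx
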